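/- Graphs are finite and simple. A graph is $3$-connected if it has more than three vertices and remains connected whenever fewer than three vertices are deleted. For $n\ge 3$ let $W_n$ be the wheel on $n+1$ vertices, that is, a cycle of length $n$ together with one further vertex adjacent to all vertices of the cycle. Graphs are identified up to isomorphism, and $\|G\|$ denotes the number of edges of $G$. Theorem. For every $3$-connected graph $G$ that is not one of the wheels $W_n$ $(n\ge 3)$, there exist an integer $t\ge 0$ and a sequence $G_0,G_1,\dots,G_t$ of $3$-connected graphs such that $G_0=G$, $G_t=W_4$, and for every $i=1,\dots,t$ the graph $G_i$ is a minor of $G_{i-1}$ with $\|G_i\|=\|G_{i-1}\|-1$; moreover, each $G_i$ $(1\le i\le t)$ is obtained from $G_{i-1}$ by deleting exactly one edge or by contracting exactly one edge. -/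

import Mathlib

namespace SimpleGraph

/-- The wheel `W_n` on `n + 1` vertices: the cycle on the rim vertices `some i`, together with the
hub `none`, which is adjacent to every rim vertex. -/
def wheel (n : ℕ) : SimpleGraph (Option (Fin n)) where
  Adj
    | none, none => False
    | none, some _ => True
    | some _, none => True
    | some i, some j => (cycleGraph n).Adj i j
  symm := ⟨by
    rintro (_ | i) (_ | j) h
    · exact h
    · trivial
    · trivial
    · exact SimpleGraph.Adj.symm h⟩
  loopless := ⟨by
    rintro (_ | i) h
    · exact h
    · exact (cycleGraph n).irrefl h⟩

/-- `G` belongs to the class `{W_n : n ≥ 3}` of wheels (up to isomorphism). -/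
def IsWheel {V : Type*} (G : SimpleGraph V) : Prop :=
  ∃ n : ℕ, 3 ≤ n ∧ Nonempty (G ≃g wheel n)

/-- A finite simple graph is `k`-connected if it has more than `k` vertices and deleting fewer than
`k` vertices always leaves a connected graph. -/
def IsKConnected {V : Type*} [Finite V] (k : ℕ) (G : SimpleGraph V) : Prop :=
  k < Nat.card V ∧ ∀ X : Set V, X.ncard < k → (G.induce Xᶜ).Connected

/-- `H` is a minor of `G`: there are pairwise disjoint, (nonempty) connected branch sets in `G`,
one for each vertex of `H`, such that adjacent vertices of `H` have branch sets joined by an edge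
of `G`. -/
def IsMinor {W V : Type*} (H : SimpleGraph W) (G : SimpleGraph V) : Prop :=
  ∃ B : W → Set V,
    (∀ w, (G.induce (B w)).Connected) ∧
    (∀ u w, u ≠ w → Disjoint (B u) (B w)) ∧
    ∀ u w, H.Adj u w → ∃ a ∈ B u, ∃ b ∈ B w, G.Adj a b

/-- The contraction of the edge `xy` in the simple graph `G`, with parallel edges merged: the vertex
`y` is removed, and `x` (now the contracted vertex) inherits the neighbours of `y`. The number of
edges drops by exactly one precisely when `x` and `y` have no common neighbour, that is, when
contracting `xy` creates no parallel edges. -/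
def contract {V : Type*} (G : SimpleGraph V) (x y : V) : SimpleGraph {v : V // v ≠ y} where
  Adj a b := a ≠ b ∧
    (G.Adj a b ∨ ((a : V) = x ∧ G.Adj y b) ∨ ((b : V) = x ∧ G.Adj y a))
  symm := ⟨by
    rintro a b ⟨hne, h | h | h⟩
    · exact ⟨hne.symm, Or.inl h.symm⟩
    · exact ⟨hne.symm, Or.inr (Or.inr h)⟩
    · exact ⟨hne.symm, Or.inr (Or.inl h)⟩⟩
  loopless := ⟨fun _ h => h.1 rfl⟩

/-- `H` is (isomorphic to) `G` with one edge deleted, or `G` with one edge contracted. -/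
def IsDeletionOrContraction {W V : Type*} (H : SimpleGraph W) (G : SimpleGraph V) : Prop :=
  ∃ x y : V, G.Adj x y ∧
    (Nonempty (H ≃g G.deleteEdges {s(x, y)}) ∨ Nonempty (H ≃g G.contract x y))

/-- The graphs `F 0, ..., F t` form a `(G, H)`-chain: up to isomorphism the first one is `G` and the
last one is `H`, and each of the others is a minor of its predecessor. The values `F i` with `i > t`
play no role. -/
def IsMinorChain {V W : Type*} (G : SimpleGraph V) (H : SimpleGraph W) (t : ℕ)
    {n : ℕ → ℕ} (F : (i : ℕ) → SimpleGraph (Fin (n i))) : Prop :=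
  Nonempty (F 0 ≃g G) ∧ Nonempty (F t ≃g H) ∧ ∀ i < t, (F (i + 1)).IsMinor (F i)

end SimpleGraph

namespace SimpleGraph

/-! The engine is Tutte's wheel theorem, `exists_isHub_of_essential`. An edge outside triangles is
one whose contraction costs exactly one edge, so the theorem says that every 3-connected graph other
than a wheel admits a step. Two undeletable edges of a triangle force a cubic vertex, by uncrossing
their separations. Without triangles, a smallest side of a 3-separation gives a contractible edge.
At a cubic vertex `v`, uncrossing again puts every edge in a triangle, so the neighbours of `v`
carry a path `a b c`. Then `b` is not cubic while `a` and `c` are, and the same `b` serves `a` and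
`c`. Going on, all vertices other than `b` are cubic neighbours of `b`, and `b` is the hub of a
wheel.

It remains to avoid ending in a wheel other than W₄. W₃ is too small to be reached. If a deletion
gives a larger wheel, the graph is a wheel with a chord, and a spoke at an end of the chord is
deleted instead (`exists_delete_of_isHub_delete`). If a contraction gives a larger wheel, the graph
is a wheel with its hub split, and a rim edge joining the two neighbourhoods is contracted instead
(`IsSplitHub.exists_contract`). Neither result is a wheel, so induction on the number of edges ends
at W₄.

Connectivity is used in the form `NoCut`: each contradiction exhibits a set with at most two outer
neighbours and a vertex beyond them. -/

variable {V : Type*} {G : SimpleGraph V}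

/-! ### Small cuts and 3-connectedness -/

/-- No set of at most two vertices separates `G`: a nonempty set `P` whose outer neighbours all lie
in `{p, q}` leaves no vertex outside `P ∪ {p, q}`. -/
def NoCut (G : SimpleGraph V) : Prop :=
  ∀ (P : Set V) (p q x o : V), x ∈ P → (∀ u ∈ P, ∀ w ∉ P, G.Adj u w → w = p ∨ w = q) →
    o ∉ P → o = p ∨ o = q

theorem Connected.exists_adj_boundary (h : G.Connected) {S : Set V} {x o : V} (hx : x ∈ S)
    (ho : o ∉ S) : ∃ u ∈ S, ∃ w ∉ S, G.Adj u w := by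
  obtain ⟨p⟩ := h.preconnected x o
  obtain ⟨d, -, h1, h2⟩ := p.exists_boundary_dart S hx ho
  exact ⟨_, h1, _, h2, d.adj⟩

theorem exists_no_adj_boundary_of_not_connected [Nonempty V] (h : ¬ G.Connected) :
    ∃ (S : Set V) (x o : V), x ∈ S ∧ o ∉ S ∧ ∀ u ∈ S, ∀ w ∉ S, ¬ G.Adj u w := by
  rw [connected_iff_exists_forall_reachable] at h
  push Not at h
  obtain ⟨x⟩ := ‹Nonempty V›
  obtain ⟨o, ho⟩ := h x
  refine ⟨{w | G.Reachable x w}, x, o, Reachable.refl x, ho, fun u hu w hw huw => hw ?_⟩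
  exact Reachable.trans hu huw.reachable

/-- If deleting `X` disconnects `G`, there is a set with outer neighbours in `X`. -/
theorem exists_separation_of_not_connected_induce {X : Set V} (hX : Xᶜ.Nonempty)
    (h : ¬ (G.induce Xᶜ).Connected) :
    ∃ (P : Set V) (x o : V), x ∈ P ∧ o ∉ P ∧ o ∉ X ∧ (∀ u ∈ P, u ∉ X) ∧
      ∀ u ∈ P, ∀ w ∉ P, G.Adj u w → w ∈ X := by
  obtain ⟨v, hv⟩ := hX
  have : Nonempty (Xᶜ : Set V) := ⟨⟨v, hv⟩⟩
  obtain ⟨S, x, o, hx, ho, hS⟩ := exists_no_adj_boundary_of_not_connected h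
  refine ⟨Subtype.val '' S, x, o, ⟨x, hx, rfl⟩, ?_, o.2, ?_, ?_⟩
  · rintro ⟨o', h1, h2⟩
    exact ho (Subtype.ext h2 ▸ h1)
  · rintro _ ⟨u, -, rfl⟩
    exact u.2
  · rintro _ ⟨u, hu, rfl⟩ w hw huw
    by_contra hwX
    exact hS u hu ⟨w, hwX⟩ (fun hc => hw ⟨_, hc, rfl⟩) huw

theorem compl_nonempty_of_ncard_lt [Finite V] {X : Set V} (h : X.ncard < Nat.card V) :
    Xᶜ.Nonempty := by
  rw [Set.nonempty_compl]
  rintro rfl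
  simp [Set.ncard_univ] at h

theorem IsKConnected.noCut [Finite V] (h : G.IsKConnected 3) : G.NoCut := by
  intro P p q x o hx hP ho
  by_contra hc
  push Not at hc
  -- `NoCut` allows `p` and `q` to lie in `P`, so only the part of the pair outside `P` is deleted.
  have hX : (({p, q} : Set V) \ P).ncard < 3 := by
    have h1 := Set.ncard_le_ncard (Set.sdiff_subset (s := ({p, q} : Set V)) (t := P))
    have h2 := Set.ncard_insert_le p {q}
    rw [Set.ncard_singleton] at h2
    omega
  have hcon := h.2 _ hX
  obtain ⟨⟨u, hu'⟩, hu, ⟨w, hw'⟩, hw, huw⟩ := hcon.exists_adj_boundary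
    (S := {v | (v : V) ∈ P}) (x := ⟨x, fun hh => hh.2 hx⟩)
    (o := ⟨o, fun hh => by simp_all⟩) hx ho
  have := hP u hu w hw huw
  exact hw' ⟨by simpa using this, hw⟩

theorem NoCut.isKConnected [Finite V] (h : G.NoCut) (hc : 3 < Nat.card V) : G.IsKConnected 3 := by
  refine ⟨hc, fun X hX => ?_⟩
  have : Nonempty V := (Nat.card_pos_iff.1 (by omega)).1
  by_contra hcon
  obtain ⟨P, x, o, hx, ho, hoX, hPX, hP⟩ := exists_separation_of_not_connected_induce
    (compl_nonempty_of_ncard_lt (by omega)) hcon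
  -- the separator may be empty, so the two exceptional vertices are chosen inside `P` or in `X`
  obtain h0 | ⟨y, hy⟩ := X.eq_empty_or_nonempty
  · have := h P x x x o hx (fun u hu w hw huw => by simpa [h0] using hP u hu w hw huw) ho
    simp only [or_self] at this
    exact ho (this ▸ hx)
  · obtain ⟨p, q, hpq⟩ : ∃ p q, X = {p, q} := by
      obtain h1 | h1 | h1 : X.ncard = 0 ∨ X.ncard = 1 ∨ X.ncard = 2 := by omega
      · rw [Set.ncard_eq_zero] at h1
        simp [h1] at hy
      · obtain ⟨a, rfl⟩ := Set.ncard_eq_one.1 h1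
        exact ⟨a, a, by simp⟩
      · obtain ⟨a, b, -, rfl⟩ := Set.ncard_eq_two.1 h1
        exact ⟨a, b, rfl⟩
    subst hpq
    exact hoX (h P p q x o hx (fun u hu w hw huw => hP u hu w hw huw) ho)

/-- Every list of fewer than `|V|` vertices misses some vertex. -/
theorem exists_not_mem_list [Finite V] (l : List V) (h : l.length < Nat.card V) : ∃ v, v ∉ l := by
  by_contra! hc
  classical
  have := Fintype.ofFinite V
  have h1 : (Finset.univ : Finset V) ⊆ l.toFinset := fun v _ => by simp [hc v]
  have h2 := (Finset.card_le_card h1).trans l.toFinset_card_le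
  rw [Finset.card_univ, ← Nat.card_eq_fintype_card] at h2
  omega

/-- A vertex of a graph without small cuts has a neighbour outside any given pair. -/
theorem NoCut.exists_adj [Finite V] (h : G.NoCut) (hc : 3 < Nat.card V) (v p q : V) :
    ∃ w, G.Adj v w ∧ w ≠ p ∧ w ≠ q := by
  by_contra! hcon
  obtain ⟨o, ho⟩ := exists_not_mem_list [v, p, q] (by simpa using hc)
  simp only [List.mem_cons, List.not_mem_nil, or_false, not_or] at ho
  have := h {v} p q v o rfl (by
    rintro u rfl w - huw
    by_cases hp : w = p
    · exact Or.inl hp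
    · exact Or.inr (hcon w huw hp)) ho.1
  tauto

/-- There is no nonempty `P` whose outer neighbours lie in `{p, q}` with a vertex outside
`P ∪ {p, q}`. -/
theorem NoCut.false_of_cut (h : G.NoCut) (P : V → Prop) (p q x o : V) (hx : P x)
    (hP : ∀ u w, P u → ¬ P w → G.Adj u w → w = p ∨ w = q) (ho : ¬ P o) (hop : o ≠ p)
    (hoq : o ≠ q) : False := by
  have := h {v | P v} p q x o hx (fun u hu w hw => hP u w hu hw) ho
  tauto

/-! ### Separations caused by failed deletions and contractions -/

/-- If deleting the edge `xy` of a 3-connected graph `G` destroys 3-connectedness, then `xy` is the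
only edge between the two sides `A ∋ x`, `B ∋ y` of a separation with separator `{s, t}`. -/
theorem exists_separation_of_delete [Finite V] (hG : G.IsKConnected 3) {x y : V} (hxy : G.Adj x y)
    (h : ¬ (G.deleteEdges {s(x, y)}).IsKConnected 3) :
    ∃ (A : Set V) (X : Set V), X.ncard < 3 ∧ x ∈ A ∧ y ∉ A ∧ y ∉ X ∧ (∀ u ∈ A, u ∉ X) ∧
      ∀ u ∈ A, ∀ w ∉ A, G.Adj u w → w ∈ X ∨ (u = x ∧ w = y) := by
  obtain ⟨X, hX, hcon⟩ : ∃ X : Set V, X.ncard < 3 ∧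
      ¬ ((G.deleteEdges {s(x, y)}).induce Xᶜ).Connected := by
    by_contra! hc
    exact h ⟨hG.1, hc⟩
  obtain ⟨P, a, o, ha, ho, hoX, hPX, hP⟩ := exists_separation_of_not_connected_induce
    (compl_nonempty_of_ncard_lt (hX.trans hG.1)) hcon
  obtain ⟨⟨u, hu'⟩, hu, ⟨w, hw'⟩, hw, huw⟩ := (hG.2 X hX).exists_adj_boundary
    (S := {v | (v : V) ∈ P}) (x := ⟨a, hPX a ha⟩) (o := ⟨o, hoX⟩) ha ho
  have huw' : G.Adj u w := huw
  have hmem : s(u, w) = s(x, y) := by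
    by_contra hne
    exact hw' (hP u hu w hw (by simpa [deleteEdges_adj, huw'] using hne))
  have hP' : ∀ u ∈ P, ∀ w ∉ P, G.Adj u w → w ∈ X ∨ s(u, w) = s(x, y) := by
    intro u hu w hw huw
    by_contra! hne
    exact hne.1 (hP u hu w hw (by simpa [deleteEdges_adj, huw] using hne.2))
  rw [Sym2.eq_iff] at hmem
  simp only [Set.mem_ofPred_eq] at hu hw
  obtain ⟨rfl, rfl⟩ | ⟨rfl, rfl⟩ := hmem
  · refine ⟨P, X, hX, hu, hw, hw', hPX, fun a ha b hb hab => ?_⟩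
    have := hP' a ha b hb hab
    rw [Sym2.eq_iff] at this
    obtain h | h | ⟨rfl, rfl⟩ := this
    · exact Or.inl h
    · exact Or.inr h
    · exact absurd ha hw
  -- Here `P` contains `y` instead of `x`, so the roles of the two sides are exchanged.
  · refine ⟨(P ∪ X)ᶜ, X, hX, by simp [hw]; exact hw', by simp [hu], hPX _ hu,
      fun a ha => by simp at ha; tauto, fun a ha b hb hab => ?_⟩
    simp only [Set.mem_compl_iff, Set.mem_union, not_or] at ha hb
    obtain hb | hb := em (b ∈ X)
    · exact Or.inl hb
    · have := hP' b (by tauto) a ha.1 hab.symm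
      rw [Sym2.eq_iff] at this
      obtain h | ⟨rfl, rfl⟩ | ⟨rfl, rfl⟩ := this
      · exact absurd h ha.2
      · exact absurd hu ha.1
      · exact Or.inr ⟨rfl, rfl⟩

theorem contract_adj {x y : V} {a b : {v : V // v ≠ y}} : (G.contract x y).Adj a b ↔
    a ≠ b ∧ (G.Adj a b ∨ ((a : V) = x ∧ G.Adj y b) ∨ ((b : V) = x ∧ G.Adj y a)) := Iff.rfl

theorem card_ne [Finite V] (y : V) : Nat.card {v : V // v ≠ y} + 1 = Nat.card V := by
  classical
  have := Fintype.ofFinite V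
  rw [Nat.card_eq_fintype_card, Nat.card_eq_fintype_card, Fintype.card_subtype_compl,
    Fintype.card_subtype_eq]
  have : 0 < Fintype.card V := Fintype.card_pos_iff.2 ⟨y⟩
  omega

/-- If contracting the edge `xy` of a 3-connected graph `G` destroys 3-connectedness, then
`{x, y, z}` separates `G` for some vertex `z`. -/
theorem exists_separation_of_contract [Finite V] (hG : G.IsKConnected 3) (hc : 5 ≤ Nat.card V)
    {x y : V} (hxy : G.Adj x y) (h : ¬ (G.contract x y).IsKConnected 3) :
    ∃ (P : Set V) (z a o : V), a ∈ P ∧ x ∉ P ∧ y ∉ P ∧ z ∉ P ∧ o ∉ P ∧ o ≠ x ∧ o ≠ y ∧ o ≠ z ∧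
      z ≠ x ∧ z ≠ y ∧
      ∀ u ∈ P, ∀ w ∉ P, G.Adj u w → w = x ∨ w = y ∨ w = z := by
  have hcard := card_ne y
  have hnc : ¬ (G.contract x y).NoCut := fun hh => h (hh.isKConnected (by omega))
  have hn := hG.noCut
  have hxy' := hxy.ne
  unfold NoCut at hnc
  push Not at hnc
  obtain ⟨P, p, q, a, o, ha, hP, ho, hop, hoq⟩ := hnc
  -- `Q` is `P` read in `V`, without `y`. If the contracted vertex lies in `P`, the set to test in
  -- `G` is `Q` together with `y`.
  set Q : Set V := {v | ∃ hv : v ≠ y, (⟨v, hv⟩ : {v : V // v ≠ y}) ∈ P} with hQ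
  have hQP : ∀ v : {v : V // v ≠ y}, (v : V) ∈ Q ↔ v ∈ P := fun v =>
    ⟨fun ⟨_, h⟩ => h, fun h => ⟨v.2, h⟩⟩
  have hyQ : y ∉ Q := fun ⟨h, _⟩ => h rfl
  have hadj : ∀ u ∈ Q, ∀ w ∉ Q, w ≠ y → G.Adj u w → w = p ∨ w = q := by
    rintro u ⟨hu, huP⟩ w hw hwy huw
    have hwP : (⟨w, hwy⟩ : {v : V // v ≠ y}) ∉ P := fun h => hw ⟨_, h⟩
    have := hP _ huP _ hwP ⟨fun e => hwP (e ▸ huP), Or.inl huw⟩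
    simpa [Subtype.ext_iff] using this
  have hadjx : x ∈ Q → ∀ w ∉ Q, w ≠ y → G.Adj y w → w = p ∨ w = q := by
    rintro ⟨hu, huP⟩ w hw hwy huw
    have hwP : (⟨w, hwy⟩ : {v : V // v ≠ y}) ∉ P := fun h => hw ⟨_, h⟩
    have := hP _ huP _ hwP ⟨fun e => hwP (e ▸ huP), Or.inr (Or.inl ⟨rfl, huw⟩)⟩
    simpa [Subtype.ext_iff] using this
  have hadjy : x ∉ Q → ∀ u ∈ Q, G.Adj u y → x = p ∨ x = q := by
    rintro hx u ⟨hu, huP⟩ huw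
    have hwP : (⟨x, hxy'⟩ : {v : V // v ≠ y}) ∉ P := fun h => hx ⟨_, h⟩
    have := hP _ huP _ hwP ⟨fun e => hwP (e ▸ huP), Or.inr (Or.inr ⟨rfl, huw.symm⟩)⟩
    simpa [Subtype.ext_iff] using this
  have haQ := (hQP a).2 ha
  have hoQ : (o : V) ∉ Q := fun h => ho ((hQP o).1 h)
  have hop' : (o : V) ≠ p := fun h => hop (Subtype.ext h)
  have hoq' : (o : V) ≠ q := fun h => hoq (Subtype.ext h)
  have hoy := o.2
  have hpy := p.2
  have hqy := q.2
  have hay := a.2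
  clear_value Q
  clear hQP hQ hP hop hoq ho ha
  generalize (a : V) = a at *
  generalize (o : V) = o at *
  generalize (p : V) = p at *
  generalize (q : V) = q at *
  -- The contracted vertex must be `p` or `q`, since otherwise the pair already cuts `G`. The other
  -- one, `r`, is the third vertex of the separator.
  have key : ∀ r : V, r ≠ y → o ≠ r → (∀ w, w = p ∨ w = q → w = x ∨ w = r) →
      o ≠ x → ∃ (P : Set V) (z a o : V), a ∈ P ∧ x ∉ P ∧ y ∉ P ∧ z ∉ P ∧ o ∉ P ∧ o ≠ x ∧
        o ≠ y ∧ o ≠ z ∧ z ≠ x ∧ z ≠ y ∧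
        ∀ u ∈ P, ∀ w ∉ P, G.Adj u w → w = x ∨ w = y ∨ w = z := by
    intro r hry hor hpq hox
    have hadj' : ∀ u ∈ Q, ∀ w ∉ Q, w ≠ y → G.Adj u w → w = x ∨ w = r :=
      fun u hu w hw hwy huw => hpq w (hadj u hu w hw hwy huw)
    have hadjx' : x ∈ Q → ∀ w ∉ Q, w ≠ y → G.Adj y w → w = x ∨ w = r :=
      fun hx w hw hwy huw => hpq w (hadjx hx w hw hwy huw)
    clear hadj hadjx hadjy hpq
    have hxQ : x ∉ Q := fun hxQ =>
      hn.false_of_cut (fun v => v = y ∨ v ∈ Q) r r y o (by simp) (by grind) (by grind) hor hor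
    by_cases hr : r ∈ Q ∨ r = x
    · exact (hn.false_of_cut (· ∈ Q) x y a o haQ (by grind) hoQ hox hoy).elim
    · exact ⟨Q, r, a, o, haQ, hxQ, hyQ, by tauto, hoQ, hox, hoy, hor, by tauto, hry, by grind⟩
  by_cases hxp : x = p
  · exact key q hqy hoq' (by simp [hxp]) (hxp ▸ hop')
  by_cases hxq : x = q
  · exact key p hpy hop' (by simp [hxq]) (hxq ▸ hoq')
  exfalso
  by_cases hxQ : x ∈ Q
  · exact hn.false_of_cut (fun v => v = y ∨ v ∈ Q) p q y o (by simp) (by grind) (by grind)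
      hop' hoq'
  · exact hn.false_of_cut (· ∈ Q) p q a o haQ (by grind) hoQ hop' hoq'

/-! ### Cubic vertices from triangles -/

/-- The vertex `v` has at most three neighbours. -/
def Cubic (G : SimpleGraph V) (v : V) : Prop :=
  ∃ a b c, ∀ w, G.Adj v w → w = a ∨ w = b ∨ w = c

/-- The two separations are uncrossed: a corner with at most two outer neighbours is empty.
Depending on where `u` and `t` lie, either one of `A`, `A'` is contained in the other and shrinks to
`x`, or the far corner is empty and `y` is left with the neighbours `x`, `z`, `t`. -/
theorem NoCut.cubic_or_cubic_of_separations (hn : G.NoCut) {x y z t u : V} {A A' : V → Prop}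
    (hxy : x ≠ y) (hxz : x ≠ z) (hyz : y ≠ z) (hxA : A x) (hyA : ¬ A y) (hzA : ¬ A z) (htA : ¬ A t)
    (hyt : y ≠ t) (hA : ∀ v w, A v → ¬ A w → G.Adj v w → w = z ∨ w = t ∨ (v = x ∧ w = y))
    (hxA' : A' x) (hyA' : ¬ A' y) (hzA' : ¬ A' z) (huA' : ¬ A' u) (hzu : z ≠ u)
    (hA' : ∀ v w, A' v → ¬ A' w → G.Adj v w → w = y ∨ w = u ∨ (v = x ∧ w = z)) :
    G.Cubic x ∨ G.Cubic y := by
  have hs : ∀ v w, G.Adj v w → G.Adj w v := fun v w h => h.symm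
  have hirr : ∀ v, ¬ G.Adj v v := fun v => G.irrefl
  have hut : t ≠ x := fun h => htA (h ▸ hxA)
  have hux : u ≠ x := fun h => huA' (h ▸ hxA')
  have finish : (∀ v, A v → v = x) → G.Cubic x := fun h =>
    ⟨y, z, t, fun w hw => by have := hA x w hxA; grind⟩
  have finish' : (∀ v, A' v → v = x) → G.Cubic x := fun h =>
    ⟨y, z, u, fun w hw => by have := hA' x w hxA'; grind⟩
  -- `A` meets the far side of `A'` only if `u ∈ A` and `t` is on the far side
  have c1 : ¬ (A u ∧ ¬ A' t ∧ t ≠ u) → ∀ v, A v → ¬ A' v → v = y ∨ v = u := by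
    intro hc v hv hv'
    by_contra! hvv
    -- By `hc`, `u` and `t` count as at most one outer neighbour of this corner, named `s`; the
    -- other one is `z`.
    obtain ⟨s, hs'⟩ : ∃ s, s ≠ x ∧ (A u → u = s) ∧ (¬ A' t → t = s) := by
      by_cases h : A u
      · exact ⟨u, hux, by grind⟩
      · exact ⟨t, hut, by grind⟩
    exact hn.false_of_cut (fun v => A v ∧ ¬ A' v ∧ v ≠ y ∧ v ≠ u) z s v x (by grind)
      (by grind) (by grind) (by grind) (by grind)
  have c2 : ¬ (A' t ∧ ¬ A u ∧ t ≠ u) → ∀ v, A' v → ¬ A v → v = z ∨ v = t := by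
    intro hc v hv hv'
    by_contra! hvv
    obtain ⟨s, hs'⟩ : ∃ s, s ≠ x ∧ (A' t → t = s) ∧ (¬ A u → u = s) := by
      by_cases h : A' t
      · exact ⟨t, hut, by grind⟩
      · exact ⟨u, hux, by grind⟩
    exact hn.false_of_cut (fun v => A' v ∧ ¬ A v ∧ v ≠ z ∧ v ≠ t) y s v x (by grind)
      (by grind) (by grind) (by grind) (by grind)
  by_cases hu : A u <;> by_cases ht : A' t
  · -- `y` is alone on its side
    right
    have c3 : ∀ v, ¬ A v → ¬ A' v → v = y ∨ v = z := by
      intro v hv hv'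
      by_contra! hvv
      exact hn.false_of_cut (fun v => ¬ A v ∧ ¬ A' v ∧ v ≠ y ∧ v ≠ z) y z v x (by grind)
        (by grind) (by grind) (by grind) (by grind)
    exact ⟨x, z, t, fun w hw => by grind⟩
  · left
    apply finish'
    intro v hv
    by_contra hvx
    exact hn.false_of_cut (fun v => A' v ∧ v ≠ x) x u v y (by grind)
        (by grind) (by grind) (by grind) (by grind)
  · left
    apply finish
    intro v hv
    by_contra hvx
    exact hn.false_of_cut (fun v => A v ∧ v ≠ x) x t v y (by grind)
        (by grind) (by grind) (by grind) (by grind)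
  · left
    apply finish
    intro v hv
    by_contra hvx
    exact hn.false_of_cut (fun v => A v ∧ v ≠ x) x t v y (by grind)
        (by grind) (by grind) (by grind) (by grind)

/-- `P` is one side of a separation of `G` with separator `{x, y, z}`, and `o` lies on the other
side. -/
structure IsSide (G : SimpleGraph V) (x y z : V) (P : V → Prop) (a o : V) : Prop where
  mem : P a
  left : ¬ P x
  middle : ¬ P y
  right : ¬ P z
  other : ¬ P o
  ne_left : o ≠ x
  ne_middle : o ≠ y
  ne_right : o ≠ z
  right_ne_left : z ≠ x
  right_ne_middle : z ≠ y
  closed : ∀ u w, P u → ¬ P w → G.Adj u w → w = x ∨ w = y ∨ w = z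

/-- Some `{x, y, z}` separates `G`. -/
def HasSeparator (G : SimpleGraph V) (x y : V) : Prop :=
  ∃ z P a o, G.IsSide x y z P a o

theorem IsSide.compl {x y z a o : V} {P : V → Prop} (h : G.IsSide x y z P a o) :
    G.IsSide x y z (fun v => ¬ P v ∧ v ≠ x ∧ v ≠ y ∧ v ≠ z) o a := by
  have hs : ∀ v w, G.Adj v w → G.Adj w v := fun v w h => h.symm
  obtain ⟨h1, h2, h3, h4, h5, h6, h7, h8, h9, h10, h11⟩ := h
  constructor <;> grind

theorem hasSeparator_of_contract [Finite V] (hG : G.IsKConnected 3) (hc : 5 ≤ Nat.card V)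
    {x y : V} (hxy : G.Adj x y) (h : ¬ (G.contract x y).IsKConnected 3) : G.HasSeparator x y := by
  obtain ⟨P, z, a, o, h1, h2, h3, h4, h5, h6, h7, h8, h9, h10, h11⟩ :=
    exists_separation_of_contract hG hc hxy h
  exact ⟨z, (· ∈ P), a, o, h1, h2, h3, h4, h5, h6, h7, h8, h9, h10,
    fun u w hu hw => h11 u hu w hw⟩

theorem Cubic.exists_eq [Finite V] (hn : G.NoCut) (hc : 3 < Nat.card V) {v a : V}
    (hv : G.Cubic v) (ha : G.Adj v a) : ∃ b c, a ≠ b ∧ a ≠ c ∧ b ≠ c ∧ G.Adj v b ∧ G.Adj v c ∧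
      ∀ w, G.Adj v w → w = a ∨ w = b ∨ w = c := by
  obtain ⟨b, hb, hba, -⟩ := hn.exists_adj hc v a a
  obtain ⟨c, hc, hca, hcb⟩ := hn.exists_adj hc v a b
  obtain ⟨p, q, r, h⟩ := hv
  refine ⟨b, c, hba.symm, hca.symm, hcb.symm, hb, hc, ?_⟩
  have h1 := h a ha
  have h2 := h b hb
  have h3 := h c hc
  intro w hw
  have h4 := h w hw
  clear h
  grind

/-- The vertex `z` sees both ends of the only edge across the separation, so it belongs to the
separator. -/
theorem exists_separation_of_delete_of_triangle [Finite V] (hG : G.IsKConnected 3) {x y z : V}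
    (hxy : G.Adj x y) (hxz : G.Adj x z) (hyz : G.Adj y z)
    (h : ¬ (G.deleteEdges {s(x, y)}).IsKConnected 3) :
    ∃ (A : V → Prop) (t : V), A x ∧ ¬ A y ∧ ¬ A z ∧ ¬ A t ∧ y ≠ t ∧
      ∀ u w, A u → ¬ A w → G.Adj u w → w = z ∨ w = t ∨ (u = x ∧ w = y) := by
  obtain ⟨A, X, hX, hxA, hyA, hyX, hAX, hA⟩ := exists_separation_of_delete hG hxy h
  have hzA : z ∉ A := fun hz => by
    obtain h | h := hA z hz y hyA hyz.symm
    · exact hyX h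
    · exact hxz.ne h.1.symm
  have hzX : z ∈ X := by
    obtain h | h := hA x hxA z hzA hxz
    · exact h
    · exact absurd h.2.symm hyz.ne
  obtain ⟨t, ht⟩ : ∃ t, X = {z, t} := by
    obtain h1 | h1 | h1 : X.ncard = 0 ∨ X.ncard = 1 ∨ X.ncard = 2 := by omega
    · rw [Set.ncard_eq_zero] at h1
      simp [h1] at hzX
    · obtain ⟨a, rfl⟩ := Set.ncard_eq_one.1 h1
      -- A separator with one vertex is `{z, t}` with `t = z`.
      exact ⟨z, by simp_all⟩
    · obtain ⟨a, b, -, rfl⟩ := Set.ncard_eq_two.1 h1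
      obtain rfl | rfl := hzX
      · exact ⟨b, rfl⟩
      · exact ⟨a, Set.pair_comm _ _⟩
  subst ht
  refine ⟨(· ∈ A), t, hxA, hyA, hzA, fun h => hAX t h (by simp), fun h => hyX (by simp [h]), ?_⟩
  intro u w hu hw huw
  have := hA u hu w hw huw
  simpa [or_assoc] using this

/-- If two edges `xy` and `xz` of a triangle cannot be deleted, then `x` or `y` is cubic. -/
theorem cubic_or_cubic_of_triangle [Finite V] (hG : G.IsKConnected 3) {x y z : V}
    (hxy : G.Adj x y) (hxz : G.Adj x z) (hyz : G.Adj y z)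
    (h : ¬ (G.deleteEdges {s(x, y)}).IsKConnected 3)
    (h' : ¬ (G.deleteEdges {s(x, z)}).IsKConnected 3) : G.Cubic x ∨ G.Cubic y := by
  obtain ⟨A, t, h1, h2, h3, h4, h5, h6⟩ :=
    exists_separation_of_delete_of_triangle hG hxy hxz hyz h
  obtain ⟨A', u, h1', h2', h3', h4', h5', h6'⟩ :=
    exists_separation_of_delete_of_triangle hG hxz hxy hyz.symm h'
  exact hG.noCut.cubic_or_cubic_of_separations hxy.ne hxz.ne hyz.ne h1 h2 h3 h4 h5 h6 h1' h3' h2'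
    h4' h5' h6'

/-! ### Contractible edges at a claw, and in the absence of triangles -/

/-- The corner containing `c` has outer neighbours only among `v`, `z`, `w`. If `z` or `w` drops
out, or they coincide, this is a small cut. Otherwise the remaining corners are empty, so `P` is
just `b`, whose only possible neighbours are then `v` and `z`. -/
theorem NoCut.false_of_claw_separations (hn : G.NoCut) {v a b c z w : V} {P P' : V → Prop}
    (hv : ∀ x, G.Adj v x → x = a ∨ x = b ∨ x = c) (hab : ¬ G.Adj a b) (hne : a ≠ b)
    (hva : v ≠ a) (hvb : v ≠ b) (hvc : v ≠ c)
    (hza : z ≠ a) (hzc : z ≠ c) (hwb : w ≠ b) (hwc : w ≠ c)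
    (hPb : P b) (hPv : ¬ P v) (hPa : ¬ P a) (hPz : ¬ P z) (hPc : ¬ P c)
    (hP : ∀ u x, P u → ¬ P x → G.Adj u x → x = v ∨ x = a ∨ x = z)
    (hPa' : P' a) (hPv' : ¬ P' v) (hPb' : ¬ P' b) (hPw' : ¬ P' w) (hPc' : ¬ P' c)
    (hP' : ∀ u x, P' u → ¬ P' x → G.Adj u x → x = v ∨ x = b ∨ x = w) : False := by
  have hs : ∀ v w, G.Adj v w → G.Adj w v := fun v w h => h.symm
  have hirr : ∀ v, ¬ G.Adj v v := fun v => G.irrefl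
  have hab' : ¬ G.Adj b a := fun h => hab h.symm
  have hwa : w ≠ a := fun h => hPw' (h ▸ hPa')
  have hzb : z ≠ b := fun h => hPz (h ▸ hPb)
  by_cases hz : ¬ P' z ∧ z ≠ w ∧ ¬ P w
  · obtain ⟨hz, hzw, hw⟩ := hz
    have c1 : ∀ u, P u → P' u ∨ u = b := by
      intro u hu
      by_contra! huu
      exact hn.false_of_cut (fun u => P u ∧ ¬ P' u ∧ u ≠ b) b z u a (by grind) (by grind)
        (by grind) (by grind) (by grind)
    have c2 : ∀ u, P' u → P u ∨ u = a := by
      intro u hu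
      by_contra! huu
      exact hn.false_of_cut (fun u => P' u ∧ ¬ P u ∧ u ≠ a) a w u b (by grind) (by grind)
        (by grind) (by grind) (by grind)
    have c3 : ∀ u, P u → ¬ P' u := by
      intro u hu hu'
      exact hn.false_of_cut (fun u => P u ∧ P' u) a b u v (by grind) (by grind)
        (by grind) (by grind) (by grind)
    exact hn.false_of_cut (fun u => P u) v z b a (by grind) (by grind)
        (by grind) (by grind) (by grind)
  · obtain ⟨s, hsa, hsz, hsw⟩ : ∃ s, s ≠ a ∧ (¬ P' z → z = s) ∧ (¬ P w → w = s) := by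
      by_cases h : ¬ P' z
      · exact ⟨z, hza, by grind⟩
      · exact ⟨w, hwa, by grind⟩
    exact hn.false_of_cut (fun u => ¬ P u ∧ ¬ P' u ∧ u ≠ v ∧ u ≠ z ∧ u ≠ w) v s c a
      (by grind) (by grind) (by grind) (by grind) (by grind)

/-- Each side of a separator `{v, a, z}` contains a neighbour of `v`, or else `{a, z}` would be a
cut. Hence `b` and `c` lie on different sides. -/
theorem NoCut.exists_side_of_claw (hn : G.NoCut) {v a b c : V}
    (hv : ∀ x, G.Adj v x → x = a ∨ x = b ∨ x = c) (h : G.HasSeparator v a) :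
    ∃ (P : V → Prop) (z : V), P b ∧ ¬ P c ∧ z ≠ c ∧ ¬ P v ∧ ¬ P a ∧ ¬ P z ∧ z ≠ a ∧ ¬ G.Adj b c ∧
      ∀ u x, P u → ¬ P x → G.Adj u x → x = v ∨ x = a ∨ x = z := by
  have key : ∀ P z p o, G.IsSide v a z P p o → P b ∨ P c := by
    intro P z p o h
    obtain ⟨h1, h2, h3, h4, h5, h6, h7, h8, h9, h10, h11⟩ := h
    by_contra! hb
    exact hn.false_of_cut P a z p o h1 (fun u x hu hx hux => by
      have := h11 u x hu hx hux
      have := hv u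
      have := hux.symm
      grind) h5 h7 h8
  obtain ⟨z, P, p, o, hP⟩ := h
  have hk := key _ _ _ _ hP
  have hk' := key _ _ _ _ hP.compl
  have hs : ∀ v w, G.Adj v w → G.Adj w v := fun v w h => h.symm
  by_cases hb : P b
  · obtain ⟨h1, h2, h3, h4, h5, h6, h7, h8, h9, h10, h11⟩ := hP
    exact ⟨P, z, hb, by grind, by grind, h2, h3, h4, h10, by grind, h11⟩
  · obtain ⟨h1, h2, h3, h4, h5, h6, h7, h8, h9, h10, h11⟩ := hP.compl
    obtain ⟨k1, k2, k3, k4, k5, k6, k7, k8, k9, k10, k11⟩ := hP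
    exact ⟨_, z, by grind, by grind, by grind, h2, h3, h4, h10, by grind, h11⟩

/-- Every edge at a cubic vertex lies in a triangle, if no edge outside triangles is contractible. -/
theorem NoCut.exists_triangle_of_cubic [Finite V] (hn : G.NoCut) (hc : 3 < Nat.card V)
    (hE : ∀ x y, G.Adj x y → (∃ z, G.Adj x z ∧ G.Adj y z) ∨ G.HasSeparator x y) {v a : V}
    (hv : G.Cubic v) (hva : G.Adj v a) : ∃ z, G.Adj v z ∧ G.Adj a z := by
  by_contra! hno
  obtain ⟨b, c, hab, hac, hbc, hvb, hvc, hN⟩ := hv.exists_eq hn hc hva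
  have hsa : G.HasSeparator v a := by
    obtain ⟨z, h1, h2⟩ | h := hE v a hva
    · exact absurd h2 (hno z h1)
    · exact h
  obtain ⟨P, z, h1, h2, h3, h4, h5, h6, h7, h8, h9⟩ := hn.exists_side_of_claw hN hsa
  -- The edge `vb` is in no triangle either: the third vertex would be `a`, against `hno`, or `c`,
  -- which lies across the separation from `b`.
  have hsb : G.HasSeparator v b := by
    obtain ⟨u, k1, k2⟩ | h := hE v b hvb
    · exfalso
      obtain rfl | rfl | rfl := hN u k1
      · exact hno b hvb k2.symm
      · exact G.irrefl k2
      · exact h8 k2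
    · exact h
  obtain ⟨P', w, h1', h2', h3', h4', h5', h6', h7', h8', h9'⟩ :=
    hn.exists_side_of_claw (a := b) (b := a) (c := c) (fun x hx => by have := hN x hx; tauto) hsb
  exact hn.false_of_claw_separations hN (hno b hvb) hab hva.ne hvb.ne hvc.ne h7 h3 h7' h3'
    h1 h4 h5 h6 h2 h9 h1' h4' h5' h6' h2' h9'

/-- In a graph without small cuts, some edge lies in no 3-separator. -/
theorem NoCut.false_of_forall_hasSeparator [Finite V] (hn : G.NoCut)
    (hE : ∀ x y, G.Adj x y → G.HasSeparator x y) {x y : V} (hxy : G.Adj x y) : False := by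
  have hs : ∀ v w, G.Adj v w → G.Adj w v := fun v w h => h.symm
  suffices H : ∀ n : ℕ, ∀ (P : V → Prop) (x y z a o : V), {v | P v}.ncard ≤ n → G.Adj x y →
      G.IsSide x y z P a o → False by
    obtain ⟨z, P, a, o, h⟩ := hE x y hxy
    exact H _ P x y z a o le_rfl hxy h
  intro n
  induction n with
  | zero =>
    intro P x y z a o hP _ h
    rw [Nat.le_zero, Set.ncard_eq_zero] at hP
    exact (hP ▸ (show a ∈ {v | P v} from h.mem) : a ∈ (∅ : Set V))
  | succ n ih =>
    intro P x y z a o hP hxy h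
    obtain ⟨h1, h2, h3, h4, h5, h6, h7, h8, h9, h10, h11⟩ := h
    obtain ⟨v, hvP, hzv⟩ : ∃ v, P v ∧ G.Adj z v := by
      by_contra! hno
      exact hn.false_of_cut P x y a o h1 (by grind) h5 h6 h7
    -- Being adjacent, `x` and `y` do not lie on opposite sides of `{z, v, w}`, so some side avoids
    -- both.
    obtain ⟨w, D, d, e, hD, hxD, hyD⟩ : ∃ w D d e, G.IsSide z v w D d e ∧ ¬ D x ∧ ¬ D y := by
      obtain ⟨w, D, d, e, hD⟩ := hE z v hzv
      by_cases hxy' : D x ∨ D y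
      · refine ⟨w, _, e, d, hD.compl, ?_⟩
        obtain ⟨k1, k2, k3, k4, k5, k6, k7, k8, k9, k10, k11⟩ := hD
        have := k11 x y
        have := k11 y x
        grind
      · push Not at hxy'
        exact ⟨w, D, d, e, hD, hxy'⟩
    obtain ⟨k1, k2, k3, k4, k5, k6, k7, k8, k9, k10, k11⟩ := hD
    obtain ⟨f, hfD, hvf⟩ : ∃ f, D f ∧ G.Adj v f := by
      by_contra! hno
      exact hn.false_of_cut D z w d e k1 (by grind) k5 k6 k8
    obtain ⟨g, hg, hgw⟩ : ∃ g, (g = x ∨ g = y) ∧ g ≠ w := by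
      by_cases hw : x = w
      · exact ⟨y, Or.inr rfl, fun h => hxy.ne (hw.trans h.symm)⟩
      · exact ⟨x, Or.inl rfl, hw⟩
    -- An edge leaving `P` inside `D` would end in `x`, `y` or `z`, none of which is in `D`. So `D ∧
    -- P` is again a side; it contains `f` and is smaller than `P` because it misses `v`.
    refine ih (fun u => D u ∧ P u) z v w f g ?_ hzv ?_
    · have : {u | D u ∧ P u}.ncard < {u | P u}.ncard :=
        Set.ncard_lt_ncard ⟨fun u hu => hu.2, fun hsub => k3 (hsub hvP).1⟩
      omega
    · constructor <;> grind

/-! ### Tutte's wheel theorem -/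

/-- The vertex `b` is adjacent to all others, each of which has exactly two further neighbours. -/
def IsHub (G : SimpleGraph V) (b : V) : Prop :=
  (∀ v, v ≠ b → G.Adj b v) ∧
    ∀ v, v ≠ b → ∃ a c, a ≠ c ∧ a ≠ b ∧ c ≠ b ∧ ∀ w, G.Adj v w ↔ w = b ∨ w = a ∨ w = c

/-- Every edge at `v` is in a triangle, so at least two of the three pairs of neighbours are
adjacent. If the common vertex `b` were cubic, `{v, b}` would have only `a` and `c` as outer
neighbours. The triangle lemma, applied to `a b v` and `c b v`, then makes `a` and `c` cubic. -/
theorem Cubic.exists_triangles [Finite V] (hG : G.IsKConnected 3) (hc : 5 ≤ Nat.card V)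
    (hD : ∀ x y, G.Adj x y → ¬ (G.deleteEdges {s(x, y)}).IsKConnected 3)
    (hE : ∀ x y, G.Adj x y → (∃ z, G.Adj x z ∧ G.Adj y z) ∨ G.HasSeparator x y) {v : V}
    (hv : G.Cubic v) : ∃ a b c, a ≠ b ∧ a ≠ c ∧ b ≠ c ∧ (∀ w, G.Adj v w ↔ w = b ∨ w = a ∨ w = c) ∧
      G.Adj b a ∧ G.Adj b c ∧ ¬ G.Cubic b ∧ G.Cubic a ∧ G.Cubic c := by
  have hn := hG.noCut
  have hs : ∀ v w, G.Adj v w → G.Adj w v := fun v w h => h.symm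
  have key : ∀ a b c, a ≠ b → a ≠ c → b ≠ c → (∀ w, G.Adj v w ↔ w = b ∨ w = a ∨ w = c) →
      G.Adj b a → G.Adj b c → ¬ G.Cubic b ∧ G.Cubic a ∧ G.Cubic c := by
    intro a b c hab hac hbc hN hba hbc'
    have hva : G.Adj v a := (hN a).2 (by simp)
    have hvb : G.Adj v b := (hN b).2 (by simp)
    have hvc : G.Adj v c := (hN c).2 (by simp)
    have hb : ¬ G.Cubic b := by
      intro hb
      obtain ⟨p, q, -, -, -, -, -, hp⟩ := hb.exists_eq hn (by omega) hba
      obtain ⟨o, ho⟩ := exists_not_mem_list [v, b, a, c] (by simp only [List.length]; omega)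
      simp only [List.mem_cons, List.not_mem_nil, or_false, not_or] at ho
      have h1 := hp v hvb.symm
      have h2 := hp c hbc'
      have := hva.ne
      have := hvc.ne
      have hp' : ∀ w, G.Adj b w → w = v ∨ w = a ∨ w = c := fun w hw => by
        have := hp w hw
        clear hp hN hD hE
        grind
      exact hn.false_of_cut (fun u => u = v ∨ u = b) a c v o (by simp)
        (by clear hp hD hE; grind) (by tauto) ho.2.2.1 ho.2.2.2
    refine ⟨hb, ?_, ?_⟩
    · have := cubic_or_cubic_of_triangle hG hba.symm hva.symm hvb.symm (hD _ _ hba.symm)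
        (hD _ _ hva.symm)
      tauto
    · have := cubic_or_cubic_of_triangle hG hbc'.symm hvc.symm hvb.symm (hD _ _ hbc'.symm)
        (hD _ _ hvc.symm)
      tauto
  obtain ⟨a, hva, -⟩ := hn.exists_adj (by omega) v v v
  obtain ⟨b, c, hab, hac, hbc, hvb, hvc, hN⟩ := hv.exists_eq hn (by omega) hva
  have hT : ∀ a, G.Adj v a → ∃ z, G.Adj v z ∧ G.Adj a z :=
    fun a ha => hn.exists_triangle_of_cubic (by omega) hE hv ha
  have hirr : ∀ v, ¬ G.Adj v v := fun v => G.irrefl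
  have path : ∀ a b c, a ≠ b → a ≠ c → b ≠ c → G.Adj v a → G.Adj v b → G.Adj v c →
      (∀ w, G.Adj v w → w = a ∨ w = b ∨ w = c) → G.Adj b a → G.Adj b c →
      ∃ a b c, a ≠ b ∧ a ≠ c ∧ b ≠ c ∧ (∀ w, G.Adj v w ↔ w = b ∨ w = a ∨ w = c) ∧
      G.Adj b a ∧ G.Adj b c ∧ ¬ G.Cubic b ∧ G.Cubic a ∧ G.Cubic c := by
    intro a b c hab hac hbc hva hvb hvc hN h1 h2
    have hN' : ∀ w, G.Adj v w ↔ w = b ∨ w = a ∨ w = c := fun w =>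
      ⟨fun h => by have := hN w h; tauto, by rintro (rfl | rfl | rfl) <;> assumption⟩
    exact ⟨a, b, c, hab, hac, hbc, hN', h1, h2, key a b c hab hac hbc hN' h1 h2⟩
  by_cases h1 : G.Adj a b
  · by_cases h2 : G.Adj b c
    · exact path a b c hab hac hbc hva hvb hvc hN h1.symm h2
    · obtain ⟨z, hz, hcz⟩ := hT c hvc
      have h3 : G.Adj a c := by
        obtain rfl | rfl | rfl := hN z hz
        · exact hcz.symm
        · exact absurd hcz.symm h2
        · exact absurd hcz G.irrefl
      exact path b a c hab.symm hbc hac hvb hva hvc (fun w hw => by have := hN w hw; tauto) h1 h3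
  · obtain ⟨z, hz, haz⟩ := hT a hva
    obtain ⟨z', hz', hbz⟩ := hT b hvb
    have h3 : G.Adj a c := by
      obtain rfl | rfl | rfl := hN z hz
      · exact absurd haz G.irrefl
      · exact absurd haz h1
      · exact haz
    have h4 : G.Adj b c := by
      obtain rfl | rfl | rfl := hN z' hz'
      · exact absurd hbz.symm h1
      · exact absurd hbz G.irrefl
      · exact hbz
    exact path a c b hac hab hbc.symm hva hvc hvb (fun w hw => by have := hN w hw; tauto)
      h3.symm h4.symm

/-- **Tutte's wheel theorem**, with the wheel given by its hub: a 3-connected graph in which no edge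
can be deleted and no edge outside triangles can be contracted has a hub. -/
theorem exists_isHub_of_essential [Finite V] (hG : G.IsKConnected 3) (hc : 5 ≤ Nat.card V)
    (hD : ∀ x y, G.Adj x y → ¬ (G.deleteEdges {s(x, y)}).IsKConnected 3)
    (hC : ∀ x y, G.Adj x y → (∃ z, G.Adj x z ∧ G.Adj y z) ∨ ¬ (G.contract x y).IsKConnected 3) :
    ∃ b, G.IsHub b := by
  have hn := hG.noCut
  have hE : ∀ x y, G.Adj x y → (∃ z, G.Adj x z ∧ G.Adj y z) ∨ G.HasSeparator x y :=
    fun x y hxy => (hC x y hxy).imp id (hasSeparator_of_contract hG hc hxy)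
  have hs : ∀ v w, G.Adj v w → G.Adj w v := fun v w h => h.symm
  obtain ⟨v, hv⟩ : ∃ v, G.Cubic v := by
    by_cases hT : ∃ x y z, G.Adj x y ∧ G.Adj x z ∧ G.Adj y z
    · obtain ⟨x, y, z, hxy, hxz, hyz⟩ := hT
      obtain h | h := cubic_or_cubic_of_triangle hG hxy hxz hyz (hD _ _ hxy) (hD _ _ hxz)
      exacts [⟨x, h⟩, ⟨y, h⟩]
    · obtain ⟨x⟩ : Nonempty V := (Nat.card_pos_iff.1 (by omega)).1
      obtain ⟨y, hxy, -⟩ := hn.exists_adj (by omega) x x x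
      refine (hn.false_of_forall_hasSeparator (fun x y hxy => (hE x y hxy).resolve_left ?_)
        hxy).elim
      rintro ⟨z, h1, h2⟩
      exact hT ⟨x, y, z, hxy, h1, h2⟩
  have hT : ∀ v, G.Cubic v → ∃ a b c, a ≠ b ∧ a ≠ c ∧ b ≠ c ∧
      (∀ w, G.Adj v w ↔ w = b ∨ w = a ∨ w = c) ∧ G.Adj b a ∧ G.Adj b c ∧ ¬ G.Cubic b ∧
      G.Cubic a ∧ G.Cubic c := fun v hv => hv.exists_triangles hG hc hD hE
  obtain ⟨a, b, c, hab, hac, hbc, hN, hba, hbc', hb, ha, hc'⟩ := hT v hv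
  -- all cubic vertices at `b` have their remaining neighbours among the cubic vertices at `b`
  have hS : ∀ v, G.Cubic v → G.Adj b v → ∃ a c, a ≠ c ∧ a ≠ b ∧ c ≠ b ∧
      (∀ w, G.Adj v w ↔ w = b ∨ w = a ∨ w = c) ∧ G.Adj b a ∧ G.Adj b c ∧ G.Cubic a ∧
      G.Cubic c := by
    intro v hv hbv
    obtain ⟨a, b', c, hab, hac, hbc, hN, hba, hbc', hb', ha, hc⟩ := hT v hv
    -- The middle neighbour of `v` must be `b` itself, since the other two are cubic and `b` is not.
    obtain rfl | rfl | rfl := (hN b).1 hbv.symm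
    · exact ⟨a, c, hac, hab, hbc.symm, hN, hba, hbc', ha, hc⟩
    · exact absurd ha hb
    · exact absurd hc hb
  have hall : ∀ v, v ≠ b → G.Cubic v ∧ G.Adj b v := by
    intro u hu
    by_contra hu'
    -- The cubic neighbours of `b` have no outer neighbour except `b`, which cannot be a cut vertex.
    refine hn.false_of_cut (fun v => G.Cubic v ∧ G.Adj b v) b b v u
      ⟨hv, ((hN b).2 (Or.inl rfl)).symm⟩ ?_ hu' hu hu
    rintro u w ⟨hu1, hu2⟩ hw huw
    obtain ⟨a, c, -, -, -, hN, h1, h2, h3, h4⟩ := hS u hu1 hu2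
    obtain rfl | rfl | rfl := (hN w).1 huw
    · exact Or.inl rfl
    · exact absurd ⟨h3, h1⟩ hw
    · exact absurd ⟨h4, h2⟩ hw
  refine ⟨b, fun v hv => (hall v hv).2, fun v hv => ?_⟩
  obtain ⟨a, c, h1, h2, h3, hN, -⟩ := hS v (hall v hv).1 (hall v hv).2
  exact ⟨a, c, h1, h2, h3, hN⟩

/-! ### Hubs characterise wheels -/

theorem IsHub.of_iso {W : Type*} {H : SimpleGraph W} (e : G ≃g H) {b : V} (h : G.IsHub b) :
    H.IsHub (e b) := by
  refine ⟨fun v hv => ?_, fun v hv => ?_⟩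
  · obtain ⟨v, rfl⟩ := e.surjective v
    exact e.map_adj_iff.2 (h.1 v (fun hh => hv (hh ▸ rfl)))
  · obtain ⟨v, rfl⟩ := e.surjective v
    obtain ⟨a, c, h1, h2, h3, hN⟩ := h.2 v (fun hh => hv (hh ▸ rfl))
    refine ⟨e a, e c, e.injective.ne h1, e.injective.ne h2, e.injective.ne h3, fun w => ?_⟩
    obtain ⟨w, rfl⟩ := e.surjective w
    rw [e.map_adj_iff, hN]
    simp [e.injective.eq_iff]

theorem isHub_wheel (n : ℕ) : (wheel (n + 3)).IsHub none := by
  refine ⟨fun v hv => ?_, fun v hv => ?_⟩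
  · obtain ⟨i, rfl⟩ := Option.ne_none_iff_exists'.1 hv
    trivial
  · obtain ⟨i, rfl⟩ := Option.ne_none_iff_exists'.1 hv
    refine ⟨some (i - 1), some (i + 1), ?_, by simp, by simp, ?_⟩
    · simp only [ne_eq, Option.some.injEq, sub_eq_iff_eq_add, add_assoc i, left_eq_add]
      exact ne_of_beq_false rfl
    · rintro (_ | j)
      · simp [wheel]
      · have h := Set.ext_iff.1 (cycleGraph_neighborSet (n := n + 1) (v := i)) j
        simp only [mem_neighborSet, Set.mem_insert_iff, Set.mem_singleton_iff] at h
        simpa [wheel] using h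

theorem IsWheel.exists_isHub (h : G.IsWheel) : ∃ b, G.IsHub b := by
  obtain ⟨n, hn, ⟨e⟩⟩ := h
  obtain ⟨m, rfl⟩ := Nat.exists_eq_add_of_le' hn
  exact ⟨_, (isHub_wheel m).of_iso e.symm⟩

/-- The rim is 2-regular, so it contains a cycle, and this cycle has no further rim neighbours. A
rim vertex off the cycle would be separated from it by `b` alone. -/
theorem IsHub.isWheel [Finite V] (hn : G.NoCut) (hc : 3 < Nat.card V) {b : V} (hb : G.IsHub b) :
    G.IsWheel := by
  classical
  obtain ⟨hb1, hb2⟩ := hb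
  -- the rim, as a graph on `V`
  let R : SimpleGraph V :=
    { Adj := fun u v => G.Adj u v ∧ u ≠ b ∧ v ≠ b
      symm := ⟨fun u v h => ⟨h.1.symm, h.2.2, h.2.1⟩⟩
      loopless := ⟨fun u h => G.irrefl h.1⟩ }
  have hR : ∀ u v, R.Adj u v ↔ G.Adj u v ∧ u ≠ b ∧ v ≠ b := fun u v => Iff.rfl
  have hRN : ∀ v, v ≠ b → ∃ a c, a ≠ c ∧ R.neighborSet v = {a, c} := by
    intro v hv
    obtain ⟨a, c, h1, h2, h3, hN⟩ := hb2 v hv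
    refine ⟨a, c, h1, ?_⟩
    ext w
    simp only [mem_neighborSet, hR, hN, Set.mem_insert_iff, Set.mem_singleton_iff]
    grind
  have hcyc : R.IsCycles := by
    rintro v ⟨w, hw⟩
    obtain ⟨a, c, h1, h2⟩ := hRN v hw.2.1
    rw [h2, Set.ncard_pair h1]
  obtain ⟨v, hv, -⟩ := hn.exists_adj hc b b b
  have hvb : v ≠ b := hv.ne'
  obtain ⟨a, c, -, hac⟩ := hRN v hvb
  obtain ⟨p, hp, -⟩ := hcyc.exists_cycle_toSubgraph_verts_eq_connectedComponentSupp
    (c := R.connectedComponentMk v) rfl ⟨a, by rw [hac]; simp⟩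
  obtain ⟨f⟩ := (cycleGraph_isContained_iff hp.three_le_length).2 ⟨v, p, hp, rfl⟩
  obtain ⟨n, hn3⟩ := Nat.exists_eq_add_of_le' hp.three_le_length
  rw [hn3] at f
  have hf : ∀ i j, (cycleGraph (n + 3)).Adj i j → R.Adj (f i) (f j) :=
    fun i j h => f.toHom.map_adj h
  have hinj : Function.Injective f := f.injective
  have hfadj : ∀ i w, R.Adj (f i) w → ∃ j, (cycleGraph (n + 3)).Adj i j ∧ w = f j := by
    intro i w hw
    obtain ⟨a, c, hac, h⟩ := hRN (f i) hw.2.1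
    have hi : (i - 1 : Fin (n + 3)) ≠ i + 1 := by
      simp only [ne_eq, sub_eq_iff_eq_add, add_assoc i, left_eq_add]
      exact ne_of_beq_false rfl
    have hset := cycleGraph_neighborSet (n := n + 1) (v := i)
    have h1 : (cycleGraph (n + 3)).Adj i (i - 1) := (Set.ext_iff.1 hset (i - 1)).2 (by simp)
    have h2 : (cycleGraph (n + 3)).Adj i (i + 1) := (Set.ext_iff.1 hset (i + 1)).2 (by simp)
    have m1 : f (i - 1) ∈ R.neighborSet (f i) := hf _ _ h1
    have m2 : f (i + 1) ∈ R.neighborSet (f i) := hf _ _ h2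
    have m3 : w ∈ R.neighborSet (f i) := hw
    have hne : f (i - 1) ≠ f (i + 1) := hinj.ne hi
    simp only [h, Set.mem_insert_iff, Set.mem_singleton_iff] at m1 m2 m3
    have : w = f (i - 1) ∨ w = f (i + 1) := by
      clear h hset
      grind
    obtain h | h := this
    exacts [⟨_, h1, h⟩, ⟨_, h2, h⟩]
  have hfb : ∀ i, f i ≠ b := fun i => by
    have h1 : (cycleGraph (n + 3)).Adj i (i + 1) :=
      (Set.ext_iff.1 (cycleGraph_neighborSet (n := n + 1) (v := i)) (i + 1)).2 (by simp)
    exact (hf _ _ h1).2.1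
  have hsurj : ∀ w, w ≠ b → ∃ i, f i = w := by
    intro w hw
    by_contra hno
    refine hn.false_of_cut (fun u => ∃ i, f i = u) b b (f 0) w ⟨0, rfl⟩ ?_ hno hw hw
    rintro _ w ⟨i, rfl⟩ hw hiw
    by_contra hwb
    obtain ⟨j, -, rfl⟩ := hfadj i w ⟨hiw, hfb i, by tauto⟩
    exact hw ⟨j, rfl⟩
  let g : Option (Fin (n + 3)) → V := fun o => o.elim b f
  have hg : Function.Bijective g := by
    constructor
    · rintro (_ | i) (_ | j) h
      · rfl
      · exact absurd h.symm (hfb j)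
      · exact absurd h (hfb i)
      · exact congrArg some (hinj h)
    · intro w
      by_cases hw : w = b
      · exact ⟨none, hw.symm⟩
      · obtain ⟨i, rfl⟩ := hsurj w hw
        exact ⟨some i, rfl⟩
  refine ⟨n + 3, by omega, ⟨(⟨Equiv.ofBijective g hg, ?_⟩ : wheel (n + 3) ≃g G).symm⟩⟩
  rintro (_ | i) (_ | j)
  · simp [wheel, g]
  · simpa [wheel, g] using hb1 _ (hfb j)
  · simpa [wheel, g] using (hb1 _ (hfb i)).symm
  · simp only [Equiv.ofBijective_apply, g, Option.elim]
    refine ⟨fun h => ?_, fun h => (hf i j h).1⟩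
    obtain ⟨k, hk, hk'⟩ := hfadj i (f j) ⟨h, hfb i, hfb j⟩
    exact hinj hk' ▸ hk

theorem IsKConnected.isWheel_iff [Finite V] (hG : G.IsKConnected 3) :
    G.IsWheel ↔ ∃ b, G.IsHub b :=
  ⟨IsWheel.exists_isHub, fun ⟨_, hb⟩ => hb.isWheel hG.noCut hG.1⟩

theorem IsWheel.nonempty_iso {n : ℕ} (h : G.IsWheel) (hc : Nat.card V = n + 1) :
    Nonempty (G ≃g wheel n) := by
  obtain ⟨m, hm, ⟨e⟩⟩ := h
  have := Nat.card_congr e.toEquiv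
  rw [hc, Nat.card_eq_fintype_card, Fintype.card_option, Fintype.card_fin] at this
  obtain rfl : m = n := by omega
  exact ⟨e⟩

theorem card_three_le_of_mem [Finite V] {X : Set V} {a b c : V} (ha : a ∈ X) (hb : b ∈ X)
    (hc : c ∈ X) (hab : a ≠ b) (hac : a ≠ c) (hbc : b ≠ c) : 3 ≤ X.ncard := by
  rw [← Set.ncard_eq_three.2 ⟨a, b, c, hab, hac, hbc, rfl⟩]
  exact Set.ncard_le_ncard (by rintro w (rfl | rfl | rfl) <;> assumption)

/-! ### Replacing a step that leads to a wheel -/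

/-- A wheel with a chord has a spoke whose deletion leaves a 3-connected graph without hub. -/
theorem exists_delete_of_isHub_delete [Finite V] (hG : G.IsKConnected 3) (hc : 6 ≤ Nat.card V)
    {x y b : V} (hxy : G.Adj x y) (hb : (G.deleteEdges {s(x, y)}).IsHub b) :
    ∃ u v, G.Adj u v ∧ (G.deleteEdges {s(u, v)}).IsKConnected 3 ∧
      ¬ ∃ h, (G.deleteEdges {s(u, v)}).IsHub h := by
  have hH : ∀ u w, (G.deleteEdges {s(x, y)}).Adj u w ↔ G.Adj u w ∧ s(u, w) ≠ s(x, y) :=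
    fun u w => by simp [deleteEdges_adj]
  obtain ⟨hb1, hb2⟩ := hb
  have hxb : x ≠ b := by
    rintro rfl
    exact ((hH x y).1 (hb1 y hxy.ne')).2 rfl
  have hyb : y ≠ b := by
    rintro rfl
    exact ((hH y x).1 (hb1 x hxy.ne)).2 Sym2.eq_swap
  have hGb : ∀ v, v ≠ b → G.Adj b v := fun v hv => ((hH b v).1 (hb1 v hv)).1
  refine ⟨x, b, (hGb x hxb).symm, ?_, ?_⟩
  · by_contra hcon
    obtain ⟨A, X, hX, hxA, hbA, hbX, hAX, hA⟩ :=
      exists_separation_of_delete hG (hGb x hxb).symm hcon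
    obtain ⟨a, c, hac, hab, hcb, hN⟩ := hb2 x hxb
    -- Every vertex of `A` is adjacent to `b` on the other side, but only `x` has an edge across. So
    -- `X` must contain three neighbours of `x`: `a`, `c` and `y`.
    have hAx : ∀ u ∈ A, u = x := by
      intro u hu
      obtain h | h := hA u hu b hbA (hGb u (fun h => hbA (h ▸ hu))).symm
      · exact absurd h hbX
      · exact h.1
    have hmem : ∀ w, G.Adj x w → w ≠ b → w ∈ X := by
      intro w hw hwb
      obtain h | h := hA x hxA w (fun h => hw.ne (hAx w h).symm) hw
      · exact h
      · exact absurd h.2 hwb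
    have ha := (hH x a).1 ((hN a).2 (by simp))
    have hc' := (hH x c).1 ((hN c).2 (by simp))
    have := card_three_le_of_mem (hmem a ha.1 hab) (hmem c hc'.1 hcb) (hmem y hxy hyb) hac
      (fun h => ha.2 (by rw [h])) (fun h => hc'.2 (by rw [h]))
    omega
  · rintro ⟨h, hh, -⟩
    have hH' : ∀ w, w ≠ h → G.Adj h w ∧ s(h, w) ≠ s(x, b) := fun w hw => by
      simpa [deleteEdges_adj] using hh w hw
    by_cases hhb : h = b
    · subst hhb
      exact (hH' x hxb).2 Sym2.eq_swap
    obtain ⟨a, c, hac, hab, hcb, hN⟩ := hb2 h hhb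
    -- A rim vertex `h` has neighbours `b`, `a`, `c` and, if it is an end of the chord, the other
    -- end `d`. Six vertices are too many for it to be a hub.
    obtain ⟨d, hd⟩ : ∃ d, ∀ w, s(h, w) = s(x, y) → w = d := by
      by_cases hx : h = x
      · refine ⟨y, fun w hw => ?_⟩
        rw [Sym2.eq_iff] at hw
        grind
      · refine ⟨x, fun w hw => ?_⟩
        rw [Sym2.eq_iff] at hw
        grind
    obtain ⟨o, ho⟩ := exists_not_mem_list [h, b, a, c, d] (by simp only [List.length]; omega)
    simp only [List.mem_cons, List.not_mem_nil, or_false, not_or] at ho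
    have h1 := (hN o).1 ((hH h o).2 ⟨(hH' o ho.1).1, fun h => ho.2.2.2.2 (hd o h)⟩)
    tauto

/-- Outside `{x, v}` the vertex `u` has at most the neighbour `u'`. So `u` can be moved into `P` or
dropped from the separator, leaving the cut `{v, x}`. -/
theorem NoCut.false_of_isSide (hn : G.NoCut) {x y u v u' a : V} {P : V → Prop} (hxy : x ≠ y)
    (hu : ∀ w, G.Adj u w → w = x ∨ w = v ∨ w = u') (hyu : y ≠ u) (hyv : y ≠ v) (ha : P a)
    (hPx : ¬ P x) (hPv : ¬ P v) (hPy : ¬ P y)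
    (hP : ∀ s w, P s → ¬ P w → G.Adj s w → w = u ∨ w = v ∨ w = x) : False := by
  have hs : ∀ v w, G.Adj v w → G.Adj w v := fun v w h => h.symm
  by_cases h : P u'
  · exact hn.false_of_cut (fun w => w = u ∨ P w) v x u y (by simp) (by grind) (by grind) hyv hxy.symm
  · exact hn.false_of_cut P v x a y ha (by grind) hPy hyv hxy.symm

/-- Two adjacent vertices `x`, `y` such that each further vertex is adjacent to exactly one of them
and has exactly two neighbours outside `{x, y}`. -/
structure IsSplitHub (G : SimpleGraph V) (x y : V) : Prop where
  adj : G.Adj x y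
  adj_or : ∀ v, v ≠ x → v ≠ y → G.Adj x v ∨ G.Adj y v
  not_adj : ∀ v, G.Adj x v → ¬ G.Adj y v
  rim : ∀ v, v ≠ x → v ≠ y → ∃ a c, a ≠ c ∧ a ≠ x ∧ a ≠ y ∧ c ≠ x ∧ c ≠ y ∧
    ∀ w, w ≠ x → w ≠ y → (G.Adj v w ↔ w = a ∨ w = c)

/-- The hub is the contracted vertex: a rim vertex has only three neighbours, whereas `x` and `y`
bring two private neighbours each. -/
theorem isSplitHub_of_isHub_contract [Finite V] (hG : G.IsKConnected 3) {x y : V}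
    (hxy : G.Adj x y) (hno : ¬ ∃ z, G.Adj x z ∧ G.Adj y z) {h : {v : V // v ≠ y}}
    (hh : (G.contract x y).IsHub h) : G.IsSplitHub x y := by
  have hn := hG.noCut
  have hs : ∀ v w, G.Adj v w → G.Adj w v := fun v w h => h.symm
  push Not at hno
  obtain ⟨h1, h2⟩ := hh
  have hhx : (h : V) = x := by
    by_contra hhx
    obtain ⟨a, c, hac, hah, hch, hN⟩ := h2 ⟨x, hxy.ne⟩ (fun e => hhx (e ▸ rfl))
    have key : ∀ w, w ≠ x → w ≠ y → G.Adj x w ∨ G.Adj y w → w = h ∨ w = a ∨ w = c := by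
      intro w hwx hwy hw
      have : (G.contract x y).Adj ⟨x, hxy.ne⟩ ⟨w, hwy⟩ :=
        ⟨fun e => hwx (Subtype.ext_iff.1 e).symm, hw.imp id fun h => Or.inl ⟨rfl, h⟩⟩
      simpa [Subtype.ext_iff] using (hN _).1 this
    obtain ⟨p, hp, hpy, -⟩ := hn.exists_adj hG.1 x y y
    obtain ⟨q, hq, hqy, hqp⟩ := hn.exists_adj hG.1 x y p
    obtain ⟨r, hr, hrx, -⟩ := hn.exists_adj hG.1 y x x
    obtain ⟨s, hs, hsx, hsr⟩ := hn.exists_adj hG.1 y x r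
    have k1 := key p hp.ne' hpy (Or.inl hp)
    have k2 := key q hq.ne' hqy (Or.inl hq)
    have k3 := key r hrx hr.ne' (Or.inr hr)
    have k4 := key s hsx hs.ne' (Or.inr hs)
    have e1 : p ≠ r := fun e => hno p hp (e ▸ hr)
    have e2 : p ≠ s := fun e => hno p hp (e ▸ hs)
    have e3 : q ≠ r := fun e => hno q hq (e ▸ hr)
    have e4 : q ≠ s := fun e => hno q hq (e ▸ hs)
    clear key hN h1 h2 hno
    generalize (h : V) = h at *
    generalize (a : V) = a at *
    generalize (c : V) = c at *
    grind
  obtain rfl : h = ⟨x, hxy.ne⟩ := Subtype.ext hhx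
  refine ⟨hxy, fun v hvx hvy => ?_, hno, fun v hvx hvy => ?_⟩
  · obtain ⟨-, h | h | h⟩ := h1 ⟨v, hvy⟩ (fun e => hvx (Subtype.ext_iff.1 e))
    · exact Or.inl h
    · exact Or.inr h.2
    · exact absurd h.1 hvx
  · obtain ⟨a, c, hac, hax, hcx, hN⟩ := h2 ⟨v, hvy⟩ (fun e => hvx (Subtype.ext_iff.1 e))
    refine ⟨a, c, fun e => hac (Subtype.ext e), fun e => hax (Subtype.ext e), a.2,
      fun e => hcx (Subtype.ext e), c.2, fun w hwx hwy => ?_⟩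
    have := hN ⟨w, hwy⟩
    simp only [contract_adj, Subtype.ext_iff, hvx, hwx, false_and, or_false, false_or] at this
    rw [← this]
    exact ⟨fun h => ⟨fun e => h.ne (Subtype.ext_iff.1 e), h⟩, fun h => h.2⟩

theorem IsSplitHub.symm {x y : V} (h : G.IsSplitHub x y) : G.IsSplitHub y x :=
  ⟨h.adj.symm, fun v h1 h2 => (h.adj_or v h2 h1).symm, fun v h1 h2 => h.not_adj v h2 h1,
    fun v h1 h2 => by
      obtain ⟨a, c, k1, k2, k3, k4, k5, k6⟩ := h.rim v h2 h1
      exact ⟨a, c, k1, k3, k2, k5, k4, fun w hw hw' => k6 w hw' hw⟩⟩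

theorem IsSplitHub.exists_rim {x y u v : V} (h : G.IsSplitHub x y) (hxu : G.Adj x u) (huy : u ≠ y)
    (huv : G.Adj u v) (hyv : G.Adj y v) (hvx : v ≠ x) : ∃ u', u' ≠ v ∧ u' ≠ x ∧ u' ≠ y ∧
      G.Adj u u' ∧ ∀ w, G.Adj u w → w = x ∨ w = v ∨ w = u' := by
  obtain ⟨a, c, hac, hax, hay, hcx, hcy, hN⟩ := h.rim u hxu.ne' huy
  have hN' : ∀ w, G.Adj u w → w = x ∨ w = a ∨ w = c := fun w hw => by
    by_cases hwx : w = x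
    · exact Or.inl hwx
    · exact Or.inr ((hN w hwx (fun e => h.not_adj u hxu (e ▸ hw.symm))).1 hw)
  have ha := (hN a hax hay).2 (Or.inl rfl)
  have hc := (hN c hcx hcy).2 (Or.inr rfl)
  obtain rfl | rfl := (hN v hvx hyv.ne').1 huv
  · exact ⟨c, hac.symm, hcx, hcy, hc, hN'⟩
  · exact ⟨a, hac, hax, hay, ha, fun w hw => by have := hN' w hw; tauto⟩

/-- If the third vertex of the separator is `x`, both sides would have to contain `y`, and vice
versa. Otherwise `x` and `y` lie on one side, and the other side is empty because every vertex is
adjacent to `x` or `y`. -/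
theorem IsSplitHub.not_hasSeparator {x y u v : V} (hn : G.NoCut) (h : G.IsSplitHub x y)
    (hxu : G.Adj x u) (huy : u ≠ y) (huv : G.Adj u v) (hyv : G.Adj y v) (hvx : v ≠ x) :
    ¬ G.HasSeparator u v := by
  obtain ⟨u', -, -, -, -, hu'⟩ := h.exists_rim hxu huy huv hyv hvx
  obtain ⟨v', -, -, -, -, hv'⟩ := h.symm.exists_rim hyv hvx huv.symm hxu huy
  have hs : ∀ v w, G.Adj v w → G.Adj w v := fun v w h => h.symm
  have hxy := h.adj
  have hor := h.adj_or
  rintro ⟨z, P, a, o, hP⟩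
  by_cases hzx : z = x
  · subst hzx
    have key : ∀ P a o, G.IsSide u v z P a o → P y := fun P a o hP => by
      by_contra hy
      exact hn.false_of_isSide hxy.ne hu' huy.symm hyv.ne hP.mem hP.right hP.middle hy hP.closed
    exact (key _ _ _ hP.compl).1 (key _ _ _ hP)
  by_cases hzy : z = y
  · subst hzy
    have key : ∀ P a o, G.IsSide u v z P a o → P x := fun P a o hP => by
      by_contra hx
      exact hn.false_of_isSide hxy.ne' hv' hvx.symm hxu.ne hP.mem hP.right hP.left
        hx (fun s w h1 h2 h3 => by have := hP.closed s w h1 h2 h3; tauto)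
    exact (key _ _ _ hP.compl).1 (key _ _ _ hP)
  obtain ⟨h1, h2, h3, h4, h5, h6, h7, h8, h9, h10, h11⟩ := hP
  have hxu' := hxu.ne
  have hyv' := hyv.ne
  have hPxy : P x ↔ P y := by
    have := h11 x y
    have := h11 y x
    grind
  by_cases hx : P x
  · have hox : o ≠ x := fun e => h5 (e ▸ hx)
    have hoy : o ≠ y := fun e => h5 (e ▸ hPxy.1 hx)
    obtain k | k := hor o hox hoy
    · have := h11 x o hx h5 k
      tauto
    · have := h11 y o (hPxy.1 hx) h5 k
      tauto
  · have hax : a ≠ x := fun e => hx (e ▸ h1)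
    have hay : a ≠ y := fun e => hx (hPxy.2 (e ▸ h1))
    obtain k | k := hor a hax hay
    · have := h11 a x h1 hx k.symm
      grind
    · have := h11 a y h1 (fun e => hx (hPxy.2 e)) k.symm
      grind

/-- The split of a large wheel at its hub has an edge whose contraction yields a 3-connected graph
without hub. -/
theorem IsSplitHub.exists_contract [Finite V] (hG : G.IsKConnected 3) (hc : 7 ≤ Nat.card V)
    {x y : V} (h : G.IsSplitHub x y) :
    ∃ u v, G.Adj u v ∧ (¬ ∃ z, G.Adj u z ∧ G.Adj v z) ∧ (G.contract u v).IsKConnected 3 ∧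
      ¬ ∃ b, (G.contract u v).IsHub b := by
  have hn := hG.noCut
  have hxy := h.adj
  have hs : ∀ v w, G.Adj v w → G.Adj w v := fun v w h => h.symm
  obtain ⟨u, v, hxu, huy, huv, hyv, hvx⟩ : ∃ u v, G.Adj x u ∧ u ≠ y ∧ G.Adj u v ∧ G.Adj y v ∧
      v ≠ x := by
    by_contra! hno
    obtain ⟨o, ho, hox, -⟩ := hn.exists_adj hG.1 y x x
    -- Without an edge between the two neighbourhoods, `y` would be a cut vertex.
    refine hn.false_of_cut (fun w => w = x ∨ (G.Adj x w ∧ w ≠ y)) y y x o (Or.inl rfl) ?_ ?_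
      ho.ne' ho.ne'
    · intro u w hu hw huw
      push Not at hw
      by_contra! hwy
      obtain k | k := h.adj_or w hw.1 hwy.1
      · exact hwy.1 (hw.2 k)
      · obtain rfl | hu := hu
        · exact h.not_adj w huw k
        · exact hw.1 (hno u w hu.1 hu.2 huw k)
    · rintro (h1 | h1)
      · exact hox h1
      · exact h.not_adj o h1.1 ho
  obtain ⟨u', hu1, hu2, hu3, hu4, hu'⟩ := h.exists_rim hxu huy huv hyv hvx
  obtain ⟨v', hv1, hv2, hv3, hv4, hv'⟩ := h.symm.exists_rim hyv hvx huv.symm hxu huy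
  have hcard := card_ne v
  refine ⟨u, v, huv, ?_, ?_, ?_⟩
  · rintro ⟨w, k1, k2⟩
    have hwx : w ≠ x := fun e => h.not_adj v (e ▸ k2.symm) hyv
    have hwy : w ≠ y := fun e => h.not_adj u hxu (e ▸ k1.symm)
    obtain ⟨o, ho⟩ := exists_not_mem_list [u, v, w, x, y] (by simp only [List.length]; omega)
    simp only [List.mem_cons, List.not_mem_nil, or_false, not_or] at ho
    obtain rfl : w = u' := by
      obtain rfl | rfl | rfl := hu' w k1
      exacts [absurd rfl hwx, absurd k2 G.irrefl, rfl]
    obtain rfl : w = v' := by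
      obtain rfl | rfl | rfl := hv' w k2
      exacts [absurd rfl hwy, absurd k1 G.irrefl, rfl]
    obtain ⟨a, c, -, -, -, -, -, hN⟩ := h.rim w hwx hwy
    have e1 := (hN u hxu.ne' huy).1 k1.symm
    have e2 := (hN v hvx hyv.ne').1 k2.symm
    have e3 := huv.ne
    refine hn.false_of_cut (fun s => s = u ∨ s = v ∨ s = w) x y u o (by simp) ?_ (by tauto)
      ho.2.2.2.1 ho.2.2.2.2
    rintro s t (rfl | rfl | rfl) ht hst
    · have := hu' t hst
      tauto
    · have := hv' t hst
      tauto
    · by_contra! hcon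
      have := (hN t hcon.1 hcon.2).1 hst
      clear hN hu' hv' hn hs
      grind
  · by_contra hcon
    exact h.not_hasSeparator hn hxu huy huv hyv hvx (hasSeparator_of_contract hG (by omega) huv hcon)
  · rintro ⟨⟨b, hbv⟩, hb, -⟩
    have hb' : ∀ w, w ≠ b → w ≠ v → G.Adj b w ∨ (b = u ∧ G.Adj v w) ∨ (w = u ∧ G.Adj v b) :=
      fun w hw hwv => (hb ⟨w, hwv⟩ (fun e => hw (Subtype.ext_iff.1 e))).2
    by_cases hbx : b = x
    · subst hbx
      obtain ⟨r, hr, hrx, hrv⟩ := hn.exists_adj hG.1 y b v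
      obtain k | k | k := hb' r hrx hrv
      · exact h.not_adj r k hr
      · exact hxu.ne k.1
      · exact h.not_adj u hxu (k.1 ▸ hr)
    by_cases hby : b = y
    · subst hby
      obtain ⟨r, hr, hry, hru⟩ := hn.exists_adj hG.1 x b u
      obtain k | k | k := hb' r hry (fun e => h.not_adj r hr (e ▸ hyv))
      · exact h.not_adj r hr k
      · exact huy k.1.symm
      · exact hru k.1
    by_cases hbu : b = u
    · subst hbu
      -- The contracted vertex has only the neighbours `x`, `y`, `u'`, `v'`; this and the last case
      -- are where seven vertices are needed.
      obtain ⟨o, ho⟩ := exists_not_mem_list [b, v, x, y, u', v'] (by simp only [List.length]; omega)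
      simp only [List.mem_cons, List.not_mem_nil, or_false, not_or] at ho
      have k1 := hu' o
      have k2 := hv' o
      have := hb' o ho.1 ho.2.1
      tauto
    · obtain ⟨a, c, -, -, -, -, -, hN⟩ := h.rim b hbx hby
      obtain ⟨z, hz⟩ : ∃ z, ∀ w, (w = x ∨ w = y) → G.Adj b w → w = z := by
        obtain k | k := h.adj_or b hbx hby
        · refine ⟨x, ?_⟩
          rintro w (rfl | rfl) hw
          exacts [rfl, absurd hw.symm (h.not_adj b k)]
        · refine ⟨y, ?_⟩
          rintro w (rfl | rfl) hw
          exacts [absurd k (h.not_adj b hw.symm), rfl]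
      obtain ⟨o, ho⟩ := exists_not_mem_list [b, v, u, a, c, z] (by simp only [List.length]; omega)
      simp only [List.mem_cons, List.not_mem_nil, or_false, not_or] at ho
      have k1 := hN o
      have k2 := hz o
      have := hb' o ho.1 ho.2.1
      tauto

/-! ### Contraction as a quotient: edge counts and minors -/

/-- The quotient map of the contraction of `xy`. -/
noncomputable def contractMap {x y : V} (hxy : x ≠ y) (v : V) : {v : V // v ≠ y} :=
  open Classical in if h : v = y then ⟨x, hxy⟩ else ⟨v, h⟩

theorem contractMap_self {x y : V} (hxy : x ≠ y) : contractMap hxy y = ⟨x, hxy⟩ := by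
  simp [contractMap]

theorem contractMap_of_ne {x y v : V} (hxy : x ≠ y) (h : v ≠ y) : contractMap hxy v = ⟨v, h⟩ := by
  simp [contractMap, h]

theorem contractMap_eq_iff {x y : V} (hxy : x ≠ y) (v : V) (w : {v : V // v ≠ y}) :
    contractMap hxy v = w ↔ v = w ∨ (v = y ∧ (w : V) = x) := by
  by_cases h : v = y
  · subst h
    have := w.2
    rw [contractMap_self, Subtype.ext_iff]
    grind
  · rw [contractMap_of_ne hxy h, Subtype.ext_iff]
    grind

theorem contract_adj_iff_exists {x y : V} (hxy : G.Adj x y) (a b : {v : V // v ≠ y}) :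
    (G.contract x y).Adj a b ↔ a ≠ b ∧ ∃ u w, G.Adj u w ∧ contractMap hxy.ne u = a ∧
      contractMap hxy.ne w = b := by
  rw [contract_adj]
  refine and_congr_right fun hab => ⟨?_, ?_⟩
  · rintro (h | ⟨h1, h2⟩ | ⟨h1, h2⟩)
    · exact ⟨a, b, h, contractMap_of_ne _ a.2, contractMap_of_ne _ b.2⟩
    · exact ⟨y, b, h2, by simp [contractMap_eq_iff, h1], contractMap_of_ne _ b.2⟩
    · exact ⟨a, y, h2.symm, contractMap_of_ne _ a.2, by simp [contractMap_eq_iff, h1]⟩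
  · rintro ⟨u, w, huw, h1, h2⟩
    rw [contractMap_eq_iff] at h1 h2
    obtain rfl | ⟨rfl, h1⟩ := h1 <;> obtain rfl | ⟨rfl, h2⟩ := h2
    · exact Or.inl huw
    · exact Or.inr (Or.inr ⟨h2, huw.symm⟩)
    · exact Or.inr (Or.inl ⟨h1, huw⟩)
    · exact absurd huw G.irrefl

/-- The quotient map takes the edges other than `xy` onto those of the contraction. Two of them
could be identified only as `xw` and `yw`, with `w` a common neighbour. -/
theorem ncard_edgeSet_contract [Finite V] {x y : V} (hxy : G.Adj x y)
    (hno : ¬ ∃ z, G.Adj x z ∧ G.Adj y z) :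
    (G.contract x y).edgeSet.ncard + 1 = G.edgeSet.ncard := by
  push Not at hno
  have himg : (G.contract x y).edgeSet =
      Sym2.map (contractMap hxy.ne) '' (G.edgeSet \ {s(x, y)}) := by
    ext e
    induction e with | _ a b => ?_
    simp only [mem_edgeSet, contract_adj_iff_exists hxy, Set.mem_image, Set.mem_sdiff,
      Set.mem_singleton_iff]
    constructor
    · rintro ⟨hab, u, w, huw, rfl, rfl⟩
      refine ⟨s(u, w), ⟨huw, fun h => hab ?_⟩, rfl⟩
      rw [Sym2.eq_iff] at h
      obtain ⟨rfl, rfl⟩ | ⟨rfl, rfl⟩ := h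
      · rw [contractMap_self, contractMap_of_ne]
      · rw [contractMap_self, contractMap_of_ne]
    · rintro ⟨e, ⟨he, hne⟩, hab⟩
      induction e with | _ u w => ?_
      have hne' : contractMap hxy.ne u ≠ contractMap hxy.ne w := by
        intro h
        have huw : G.Adj u w := he
        have := huw.ne
        rw [contractMap_eq_iff] at h
        by_cases hw : w = y
        · subst hw
          rw [contractMap_self] at h
          simp only at h
          obtain h | h := h
          · exact hne (by rw [h])
          · exact this h.1
        · rw [contractMap_of_ne _ hw] at h
          simp only at h
          obtain h | h := h
          · exact this h
          · exact hne (by rw [h.1, h.2, Sym2.eq_swap])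
      rw [Sym2.map_mk, Sym2.eq_iff] at hab
      obtain ⟨rfl, rfl⟩ | ⟨rfl, rfl⟩ := hab
      · exact ⟨hne', u, w, he, rfl, rfl⟩
      · exact ⟨hne'.symm, w, u, G.adj_symm he, rfl, rfl⟩
  have hinj : Set.InjOn (Sym2.map (contractMap hxy.ne)) (G.edgeSet \ {s(x, y)}) := by
    have hs : ∀ v w, G.Adj v w → G.Adj w v := fun v w h => h.symm
    have hxy' := hxy.ne
    have hval : ∀ u w, contractMap hxy.ne u = contractMap hxy.ne w →
        u = w ∨ (u = x ∧ w = y) ∨ (u = y ∧ w = x) := by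
      intro u w h
      rw [contractMap_eq_iff] at h
      by_cases hw : w = y
      · subst hw
        rw [contractMap_self] at h
        tauto
      · rw [contractMap_of_ne _ hw] at h
        tauto
    have key : ∀ u w u' w', G.Adj u w → G.Adj u' w' → s(u, w) ≠ s(x, y) → s(u', w') ≠ s(x, y) →
        contractMap hxy.ne u = contractMap hxy.ne u' →
        contractMap hxy.ne w = contractMap hxy.ne w' → s(u, w) = s(u', w') := by
      intro u w u' w' h1 h2 h3 h4 h5 h6
      have k1 := hval _ _ h5
      have k2 := hval _ _ h6
      have hirr : ∀ v, ¬ G.Adj v v := fun v => G.irrefl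
      rw [ne_eq, Sym2.eq_iff] at h3 h4
      rw [Sym2.eq_iff]
      clear h5 h6 hval himg
      grind
    rintro e ⟨he, hne⟩ e' ⟨he', hne'⟩ h
    induction e with | _ u w => ?_
    induction e' with | _ u' w' => ?_
    rw [Sym2.map_mk, Sym2.map_mk, Sym2.eq_iff] at h
    obtain ⟨h1, h2⟩ | ⟨h1, h2⟩ := h
    · exact key _ _ _ _ he he' hne hne' h1 h2
    · rw [Sym2.eq_swap (a := u')] at hne' ⊢
      exact key _ _ _ _ he (G.adj_symm he') hne hne' h1 h2
  rw [himg, hinj.ncard_image]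
  exact Set.ncard_sdiff_singleton_add_one hxy

theorem ncard_edgeSet_deleteEdges [Finite V] {x y : V} (hxy : G.Adj x y) :
    (G.deleteEdges {s(x, y)}).edgeSet.ncard + 1 = G.edgeSet.ncard := by
  rw [edgeSet_deleteEdges]
  exact Set.ncard_sdiff_singleton_add_one hxy

theorem isMinor_of_map {W : Type*} {H : SimpleGraph W} (f : V → W)
    (hf : ∀ w, (G.induce {v | f v = w}).Connected)
    (hH : ∀ a b, H.Adj a b → ∃ u w, G.Adj u w ∧ f u = a ∧ f w = b) : H.IsMinor G := by
  refine ⟨fun w => {v | f v = w}, hf, fun u w huw => ?_, fun a b hab => ?_⟩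
  · rw [Set.disjoint_left]
    exact fun v h1 h2 => huw (h1.symm.trans h2)
  · obtain ⟨u, w, huw, h1, h2⟩ := hH a b hab
    exact ⟨u, h1, w, h2, huw⟩

theorem isMinor_deleteEdges (s : Set (Sym2 V)) : (G.deleteEdges s).IsMinor G := by
  refine isMinor_of_map id (fun w => ?_) fun a b hab => ⟨a, b, deleteEdges_le s hab, rfl, rfl⟩
  have : {v : V | id v = w} = {w} := rfl
  rw [this]
  exact Connected.of_subsingleton

theorem isMinor_contract {x y : V} (hxy : G.Adj x y) : (G.contract x y).IsMinor G := by
  refine isMinor_of_map (contractMap hxy.ne) (fun w => ?_)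
    fun a b hab => ((contract_adj_iff_exists hxy a b).1 hab).2
  by_cases hw : (w : V) = x
  · have : {v : V | contractMap hxy.ne v = w} = {x, y} := by
      ext v
      simp [contractMap_eq_iff, hw]
    rw [this]
    exact induce_pair_connected_of_adj hxy
  · have : {v : V | contractMap hxy.ne v = w} = {(w : V)} := by
      ext v
      simp [contractMap_eq_iff, hw]
    rw [this]
    exact Connected.of_subsingleton

theorem IsMinor.of_iso {W W' : Type*} {H : SimpleGraph W} {H' : SimpleGraph W'} (e : H' ≃g H)
    (h : H.IsMinor G) : H'.IsMinor G := by
  obtain ⟨B, h1, h2, h3⟩ := h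
  exact ⟨fun w => B (e w), fun w => h1 _, fun u w huw => h2 _ _ (e.injective.ne huw),
    fun u w huw => h3 _ _ (e.map_adj_iff.2 huw)⟩

theorem IsDeletionOrContraction.isMinor {W : Type*} {H : SimpleGraph W}
    (h : H.IsDeletionOrContraction G) : H.IsMinor G := by
  obtain ⟨x, y, hxy, ⟨⟨e⟩⟩ | ⟨⟨e⟩⟩⟩ := h
  · exact (isMinor_deleteEdges _).of_iso e
  · exact (isMinor_contract hxy).of_iso e

/-! ### Invariance under isomorphism, and small graphs -/

theorem NoCut.of_iso {W : Type*} {H : SimpleGraph W} (e : G ≃g H) (h : G.NoCut) : H.NoCut := by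
  intro P p q x o hx hP ho
  have := h (e ⁻¹' P) (e.symm p) (e.symm q) (e.symm x) (e.symm o) (by simpa using hx)
    (fun u hu w hw huw => by
      simpa [RelIso.eq_symm_apply] using hP (e u) hu (e w) hw (e.map_adj_iff.2 huw))
    (by simpa using ho)
  simpa using this

theorem IsKConnected.of_iso {W : Type*} [Finite V] [Finite W] {H : SimpleGraph W} (e : G ≃g H)
    (h : G.IsKConnected 3) : H.IsKConnected 3 :=
  (h.noCut.of_iso e).isKConnected (Nat.card_congr e.toEquiv ▸ h.1)

theorem IsWheel.of_iso {W : Type*} {H : SimpleGraph W} (e : G ≃g H) (h : G.IsWheel) :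
    H.IsWheel := by
  obtain ⟨n, hn, ⟨f⟩⟩ := h
  exact ⟨n, hn, ⟨e.symm.trans f⟩⟩

theorem ncard_edgeSet_of_iso {W : Type*} {H : SimpleGraph W} (e : G ≃g H) :
    G.edgeSet.ncard = H.edgeSet.ncard := by
  rw [← Nat.card_coe_set_eq, ← Nat.card_coe_set_eq]
  exact Nat.card_congr e.mapEdgeSet

/-- A graph on four vertices without small cuts is complete. -/
theorem NoCut.adj_of_card_eq_four [Finite V] (hn : G.NoCut) (hc : Nat.card V = 4) {x y : V}
    (hxy : x ≠ y) : G.Adj x y := by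
  by_contra h
  obtain ⟨p, hp⟩ := exists_not_mem_list [x, y] (by simp [hc])
  obtain ⟨q, hq⟩ := exists_not_mem_list [x, y, p] (by simp [hc])
  obtain ⟨w, hw, hwp, hwq⟩ := hn.exists_adj (by omega) x p q
  simp only [List.mem_cons, List.not_mem_nil, or_false, not_or] at hp hq
  have hwy : w ≠ y := fun e => h (e ▸ hw)
  have hwx := hw.ne'
  have := Fintype.ofFinite V
  have h5 : [x, y, p, q, w].Nodup := by
    simp
    grind
  have := h5.length_le_card
  rw [← Nat.card_eq_fintype_card] at this
  simp only [List.length] at this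
  omega

theorem wheel_three_eq_top : wheel 3 = ⊤ := by
  ext (_ | i) (_ | j)
  · simp [wheel]
  · simp [wheel]
  · simp [wheel]
  · simp [wheel, cycleGraph_three_eq_top]

theorem NoCut.isWheel_of_card_eq_four [Finite V] (hn : G.NoCut) (hc : Nat.card V = 4) :
    G.IsWheel := by
  refine ⟨3, le_rfl, ?_⟩
  have hG : G = ⊤ := by
    ext x y
    exact ⟨fun h => h.ne, fun h => hn.adj_of_card_eq_four hc h⟩
  rw [hG, wheel_three_eq_top]
  obtain ⟨e⟩ := (Finite.card_eq (α := V) (β := Option (Fin 3))).1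
    (by rw [hc, Nat.card_eq_fintype_card, Fintype.card_option, Fintype.card_fin])
  exact ⟨Iso.completeGraph e⟩

/-- Two adjacent vertices without common neighbours have two private neighbours each. -/
theorem NoCut.six_le_card [Finite V] (hn : G.NoCut) (hc : 3 < Nat.card V) {x y : V}
    (hxy : G.Adj x y) (hno : ¬ ∃ z, G.Adj x z ∧ G.Adj y z) : 6 ≤ Nat.card V := by
  push Not at hno
  obtain ⟨p, hp, hpy, -⟩ := hn.exists_adj hc x y y
  obtain ⟨q, hq, hqy, hqp⟩ := hn.exists_adj hc x y p
  obtain ⟨r, hr, hrx, -⟩ := hn.exists_adj hc y x x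
  obtain ⟨s, hs, hsx, hsr⟩ := hn.exists_adj hc y x r
  have e1 : p ≠ r := fun e => hno p hp (e ▸ hr)
  have e2 : p ≠ s := fun e => hno p hp (e ▸ hs)
  have e3 : q ≠ r := fun e => hno q hq (e ▸ hr)
  have e4 : q ≠ s := fun e => hno q hq (e ▸ hs)
  have := hxy.ne
  have := hp.ne
  have := hq.ne
  have := hr.ne
  have := hs.ne
  have := Fintype.ofFinite V
  have h6 : [x, y, p, q, r, s].Nodup := by
    simp
    grind
  have := h6.length_le_card
  rwa [← Nat.card_eq_fintype_card] at this

/-! ### One step, and the chain -/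

/-- A 3-connected graph other than a wheel has an edge whose deletion, or whose contraction without
creating parallel edges, gives a 3-connected graph that is `W₄` or not a wheel. -/
theorem IsKConnected.exists_deletion_or_contraction [Finite V] (hG : G.IsKConnected 3)
    (hW : ¬ G.IsWheel) : ∃ x y, G.Adj x y ∧
      (((G.deleteEdges {s(x, y)}).IsKConnected 3 ∧
        (¬ (G.deleteEdges {s(x, y)}).IsWheel ∨ Nonempty (G.deleteEdges {s(x, y)} ≃g wheel 4))) ∨
      ((¬ ∃ z, G.Adj x z ∧ G.Adj y z) ∧ (G.contract x y).IsKConnected 3 ∧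
        (¬ (G.contract x y).IsWheel ∨ Nonempty (G.contract x y ≃g wheel 4)))) := by
  have hn := hG.noCut
  have hc : 5 ≤ Nat.card V := by
    by_contra hc
    exact hW (hn.isWheel_of_card_eq_four (by have := hG.1; omega))
  by_cases hD : ∃ x y, G.Adj x y ∧ (G.deleteEdges {s(x, y)}).IsKConnected 3
  · obtain ⟨x, y, hxy, hH⟩ := hD
    by_cases hHW : (G.deleteEdges {s(x, y)}).IsWheel
    -- A wheel on five vertices is W₄ and is accepted as the end of the chain; larger ones are
    -- avoided.
    · obtain hc | hc := hc.eq_or_lt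
      · exact ⟨x, y, hxy, Or.inl ⟨hH, Or.inr (hHW.nonempty_iso hc.symm)⟩⟩
      · obtain ⟨b, hb⟩ := hHW.exists_isHub
        obtain ⟨u, v, huv, h1, h2⟩ := exists_delete_of_isHub_delete hG hc hxy hb
        exact ⟨u, v, huv, Or.inl ⟨h1, Or.inl fun h => h2 h.exists_isHub⟩⟩
    · exact ⟨x, y, hxy, Or.inl ⟨hH, Or.inl hHW⟩⟩
  by_cases hC : ∃ x y, G.Adj x y ∧ (¬ ∃ z, G.Adj x z ∧ G.Adj y z) ∧
      (G.contract x y).IsKConnected 3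
  · obtain ⟨x, y, hxy, hno, hH⟩ := hC
    by_cases hHW : (G.contract x y).IsWheel
    · have hcard := card_ne y
      obtain hc | hc := (hn.six_le_card hG.1 hxy hno).eq_or_lt
      · exact ⟨x, y, hxy, Or.inr ⟨hno, hH, Or.inr (hHW.nonempty_iso (by omega))⟩⟩
      · obtain ⟨b, hb⟩ := hHW.exists_isHub
        obtain ⟨u, v, huv, h1, h2, h3⟩ :=
          (isSplitHub_of_isHub_contract hG hxy hno hb).exists_contract hG hc
        exact ⟨u, v, huv, Or.inr ⟨h1, h2, Or.inl fun h => h3 h.exists_isHub⟩⟩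
    · exact ⟨x, y, hxy, Or.inr ⟨hno, hH, Or.inl hHW⟩⟩
  exfalso
  push Not at hD hC
  refine hW (hG.isWheel_iff.2 (exists_isHub_of_essential hG hc hD fun x y hxy => ?_))
  by_cases h : ∃ z, G.Adj x z ∧ G.Adj y z
  · exact Or.inl h
  · exact Or.inr (hC x y hxy (by simpa using h))

theorem exists_iso_fin [Finite V] (G : SimpleGraph V) :
    ∃ (n : ℕ) (H : SimpleGraph (Fin n)), Nonempty (H ≃g G) :=
  ⟨_, _, ⟨(Iso.map (Finite.equivFin V) G).symm⟩⟩

theorem IsKConnected.exists_step [Finite V] (hG : G.IsKConnected 3) (hW : ¬ G.IsWheel) :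
    ∃ (m : ℕ) (H : SimpleGraph (Fin m)), H.IsKConnected 3 ∧
      (¬ H.IsWheel ∨ Nonempty (H ≃g wheel 4)) ∧ H.edgeSet.ncard + 1 = G.edgeSet.ncard ∧
      H.IsDeletionOrContraction G := by
  obtain ⟨x, y, hxy, ⟨h1, h2⟩ | ⟨hno, h1, h2⟩⟩ := hG.exists_deletion_or_contraction hW
  · obtain ⟨m, H, ⟨e⟩⟩ := exists_iso_fin (G.deleteEdges {s(x, y)})
    exact ⟨m, H, h1.of_iso e.symm,
      h2.imp (fun h h' => h (h'.of_iso e)) (fun ⟨f⟩ => ⟨e.trans f⟩),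
      by rw [ncard_edgeSet_of_iso e, ncard_edgeSet_deleteEdges hxy], x, y, hxy, Or.inl ⟨e⟩⟩
  · obtain ⟨m, H, ⟨e⟩⟩ := exists_iso_fin (G.contract x y)
    exact ⟨m, H, h1.of_iso e.symm,
      h2.imp (fun h h' => h (h'.of_iso e)) (fun ⟨f⟩ => ⟨e.trans f⟩),
      by rw [ncard_edgeSet_of_iso e, ncard_edgeSet_contract hxy hno], x, y, hxy, Or.inr ⟨e⟩⟩

/-- Induction on the number of edges; the alternative in `hW` is what a step returns, and W₄ stops
the chain. The sigma type carries the varying vertex count, so that a graph can be prepended to the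
sequence. -/
theorem exists_chain_to_wheel_four (N k : ℕ) (G : SimpleGraph (Fin k)) (hN : G.edgeSet.ncard = N)
    (hG : G.IsKConnected 3) (hW : ¬ G.IsWheel ∨ Nonempty (G ≃g wheel 4)) :
    ∃ (t : ℕ) (F : ℕ → Σ n, SimpleGraph (Fin n)), F 0 = ⟨k, G⟩ ∧
      Nonempty ((F t).2 ≃g wheel 4) ∧ (∀ i ≤ t, (F i).2.IsKConnected 3) ∧
      ∀ i < t, (F (i + 1)).2.edgeSet.ncard + 1 = (F i).2.edgeSet.ncard ∧
        (F (i + 1)).2.IsDeletionOrContraction (F i).2 := by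
  induction N generalizing k G with
  | zero =>
    obtain hW | hW := hW
    · obtain ⟨m, H, -, -, h, -⟩ := hG.exists_step hW
      omega
    · exact ⟨0, fun _ => ⟨k, G⟩, rfl, hW, fun _ _ => hG, fun i hi => absurd hi (Nat.not_lt_zero i)⟩
  | succ N ih =>
    obtain hW | hW := hW
    · obtain ⟨m, H, h1, h2, h3, h4⟩ := hG.exists_step hW
      obtain ⟨t, F, k0, k1, k2, k3⟩ := ih m H (by omega) h1 h2
      refine ⟨t + 1, fun i => Nat.casesOn i ⟨k, G⟩ F, rfl, k1, ?_, ?_⟩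
      · rintro (_ | i) hi
        · exact hG
        · exact k2 i (by omega)
      · rintro (_ | i) hi
        · change (F 0).2.edgeSet.ncard + 1 = G.edgeSet.ncard ∧ (F 0).2.IsDeletionOrContraction G
          rw [k0]
          exact ⟨h3, h4⟩
        · exact k3 i (by omega)
    · exact ⟨0, fun _ => ⟨k, G⟩, rfl, hW, fun _ _ => hG, fun i hi => absurd hi (Nat.not_lt_zero i)⟩

end SimpleGraph

theorem theorem8 {V : Type*} [Finite V] (G : SimpleGraph V)
    (hG : G.IsKConnected 3) (hW : ¬ G.IsWheel) :
    ∃ (t : ℕ) (n : ℕ → ℕ) (F : (i : ℕ) → SimpleGraph (Fin (n i))),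
      G.IsMinorChain (SimpleGraph.wheel 4) t F ∧
      (∀ i ≤ t, (F i).IsKConnected 3) ∧
      ∀ i < t,
        (F (i + 1)).edgeSet.ncard + 1 = (F i).edgeSet.ncard ∧
        (F (i + 1)).IsDeletionOrContraction (F i) := by
  obtain ⟨k, H, ⟨e⟩⟩ := SimpleGraph.exists_iso_fin G
  obtain ⟨t, F, h0, h1, h2, h3⟩ := SimpleGraph.exists_chain_to_wheel_four _ k H rfl
    (hG.of_iso e.symm) (Or.inl fun h => hW (h.of_iso e))
  refine ⟨t, fun i => (F i).1, fun i => (F i).2, ⟨?_, h1, fun i hi => (h3 i hi).2.isMinor⟩, h2, h3⟩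
  change Nonempty ((F 0).2 ≃g G)
  rw [h0]
  exact ⟨e⟩
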